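/- There are absolute constants $a,\beta\in\mathbb{N}$ such that for every $c\in\mathbb{N}$ there are a constant $C$ (depending only on $c$) and a family of randomized congested-clique algorithms $A_{n,k}$ ($n,k\ge 1$) with the following property. For all integers $n,k\ge 1$, the algorithm $A_{n,k}$ uses at most $C\log k$ rounds, and for every unweighted undirected simple graph $G$ (connected or not) on the $n$ vertices, with probability at least $1-n^{-c}$ it constructs a $(2k-1)$-spanner $H$ of $G$ with $$|E(H)|\le C\cdot k\cdot n^{1+1/k}\cdot(\log n)^a ,$$ that is, with $\widetilde O(k\cdot n^{1+1/k})$ edges. Here a $t$-spanner of $G$ is a subgraph $H\subseteq G$ on the same vertex set with $\mathrm{dist}_H(u,v)\le t\cdot \mathrm{dist}_G(u,v)$ for all vertices $u,v$ (with $\mathrm{dist}=\infty$ between different components). In the congested clique, the $n$ vertices are the processors; initially each knows $n$, $k$, its identifier in $\{0,\dots,n-1\}$, its neighbours in $G$, and a finite string of private, independent, fair random bits. In each synchronous round every vertex sends a message of $\beta\lceil\log_2 n\rceil$ bits to every vertex (possibly different messages to different vertices); local computation is unrestricted. $H$ is constructed if at the end every vertex outputs exactly the set of its neighbours in $H$.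 -/

import Mathlib

/-- `H` is a `t`-spanner of `G`: a subgraph (on the same vertex set) in which every distance is at
most `t` times the distance in `G`. Distances are extended, so pairs of vertices in different
components of `G` impose no condition. -/
def IsSpanner {V : Type*} (t : ℕ) (G H : SimpleGraph V) : Prop :=
  H ≤ G ∧ ∀ u v : V, H.edist u v ≤ (t : ℕ∞) * G.edist u v

namespace CongestedClique

/-- A randomized algorithm in the congested clique with `n` nodes (whose identifiers are the
elements of `Fin n`) and messages of `b` bits. Local computation is unrestricted. Every node starts
with its own identifier, the set of its neighbours in the input graph and a private string of
random bits. In every round each node sends to each node a message of `b` bits (possibly a different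
one to each node), which depends only on its own local state, and then updates its state
from the messages it received. After the last round every node outputs a set of nodes. -/
structure Algorithm (n b : ℕ) where
  /-- the number of communication rounds -/
  rounds : ℕ
  /-- the number of private random bits of each node -/
  coins : ℕ
  /-- the local states of a node -/
  State : Type
  /-- the initial state of a node, from its identifier, its neighbours and its random bits -/
  init : Fin n → Set (Fin n) → (Fin coins → Bool) → State
  /-- `send t u s v` is the message that node `u`, in state `s`, sends to node `v` in round `t` -/
  send : ℕ → Fin n → State → Fin n → (Fin b → Bool)
  /-- `recv t v s m` is the state of node `v` after round `t`, if its state before that round was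
  `s` and the message it received from each node `u` is `m u` -/
  recv : ℕ → Fin n → State → (Fin n → (Fin b → Bool)) → State
  /-- the output of a node in its final state -/
  output : Fin n → State → Set (Fin n)

namespace Algorithm

variable {n b : ℕ} (A : Algorithm n b)

/-- The random bits of all nodes. -/
abbrev Coins : Type := Fin n → Fin A.coins → Bool

/-- The local state of every node after `t` rounds on the input graph `G`, with random bits `ω`. -/
def stateAt (G : SimpleGraph (Fin n)) (ω : A.Coins) : ℕ → Fin n → A.State
  | 0 => fun v => A.init v (G.neighborSet v) (ω v)
  | t + 1 => fun v =>
      A.recv t v (stateAt G ω t v) (fun u => A.send t u (stateAt G ω t u) v)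

/-- The output of every node on the input graph `G`, with random bits `ω`. -/
def run (G : SimpleGraph (Fin n)) (ω : A.Coins) (v : Fin n) : Set (Fin n) :=
  A.output v (A.stateAt G ω A.rounds v)

/-- In the run on `G` with random bits `ω` the graph `H` is constructed: every node outputs
exactly the set of its neighbours in `H`. -/
def Constructs (G : SimpleGraph (Fin n)) (ω : A.Coins) (H : SimpleGraph (Fin n)) : Prop :=
  ∀ v, A.run G ω v = H.neighborSet v

/-- The probability of an event, when all random bits of all nodes are independent and fair. -/
noncomputable def prob (E : Set A.Coins) : ℝ :=
  (E.ncard : ℝ) / (Fintype.card A.Coins : ℝ)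

end Algorithm

end CongestedClique

/-!
The cases `k = 1` and `n ≤ k` need no communication: the whole graph is sparse enough. Otherwise
the spanner is a variant of the one of Baswana and Sen, computed from truncated distance tables.

*The spanner.* Every vertex draws `⌈log₂ n⌉` random bits, and a decreasing sequence of sets of bit
strings (`exists_samples`) turns them into random sets of centers `A 0 ⊇ A 1 ⊇ ...`, where `A 0`
contains all vertices and `A i` has density about `n ^ (- i / k)` up to a logarithmic factor. A
vertex within distance `i` of `A i` belongs to the cluster of level `i` of its nearest center. Let
`d = (k - 1) / 2` and `d' = k / 2`, so that `d + d' = k - 1`. The spanner (`clusterSpanner`)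
consists of shortest paths inside the clusters of levels up to `d'`; for every vertex that is
unclustered at some level `≤ d'`, one edge to every adjacent cluster of level `i`, where `i + 1` is
the first such level; and one edge between every cluster of level `d` and every adjacent cluster of
level `d'`. If `i + 1` is the first level `≤ d'` at which an endpoint of an edge is unclustered,
then the edge is stretched to at most `2 * i + 1`; without such a level, it is stretched to at most
`2 * (d + d') + 1 = 2 * k - 1` (`isSpanner_clusterSpanner`).
A vertex with more than about `n ^ (1 / k) * log n` adjacent clusters of level `i` has a center of
level `i + 1` within distance `i + 1` with high probability, and
`|A d| * |A d'|` is about `n ^ (2 - (d + d') / k) = n ^ (1 + 1 / k)`; this bounds the number of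
edges (`IsGoodSample.ncard_edgeSet_le`). All tail bounds come from Markov's inequality for a
product over the vertices (`freq_le_of_prod`).

*The algorithm.* As `i ≤ k / 2`, with high probability the `√n` vertices nearest to `v` meet `A i`,
so the clusters of `v` can be read off the list of its `√n` nearest vertices within
distance `k / 2` (`center_nearDist`). The lists for radius `2 * R` are a truncated min-plus product
of those for radius `R` (`truncate_iInf_nearDist`), and since a list has at most `√n` entries, each
vertex can fetch the lists of all members of its own list in two rounds: the `n` vertices serve as
intermediaries, one for every pair (position of the request, position in the requested list), and
every vertex sends its request and its entry for that pair to the intermediary (`Knows.gather`).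
Hence `O(log k)` rounds give the lists for radius `k / 2` (`knows_nearDist`), and a constant number
of rounds turns the clusters into the spanner (`knows_clusterSpanner`).
-/

/-! ### Locally computable functions -/

namespace CongestedClique

/-- Everything a node has seen: its neighbours, its random bits, and the messages that arrived in
each round (`inbox t u` came from `u` in round `t`; later rounds hold a default value). -/
structure View (n b m : ℕ) where
  /-- the neighbours of the node in the input graph -/
  nbrs : Set (Fin n)
  /-- the random bits of the node -/
  bits : Fin m → Bool
  /-- the messages received so far -/
  inbox : ℕ → Fin n → Fin b → Bool

variable {n b m : ℕ}

/-- What every node has seen after `t` rounds in which everybody sends according to `send`. -/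
def views (send : ℕ → Fin n → View n b m → Fin n → (Fin b → Bool)) (G : SimpleGraph (Fin n))
    (ω : Fin n → Fin m → Bool) : ℕ → Fin n → View n b m
  | 0 => fun v => ⟨G.neighborSet v, ω v, fun _ _ _ => false⟩
  | t + 1 => fun v => ⟨(views send G ω t v).nbrs, (views send G ω t v).bits,
      Function.update (views send G ω t v).inbox t fun u => send t u (views send G ω t u) v⟩

/-- The views up to time `T` only depend on what is sent before time `T`. -/
theorem views_congr {send send' : ℕ → Fin n → View n b m → Fin n → (Fin b → Bool)} {T : ℕ}
    (h : ∀ t < T, send t = send' t) (G : SimpleGraph (Fin n)) (ω : Fin n → Fin m → Bool) :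
    views send G ω T = views send' G ω T := by
  induction T with
  | zero => rfl
  | succ T ih =>
    have ih := ih (fun t ht => h t (by omega))
    simp only [views, ih, h T (by omega)]

/-- Nothing is in the inbox of a round that has not yet taken place. -/
theorem views_inbox (send : ℕ → Fin n → View n b m → Fin n → (Fin b → Bool))
    (G : SimpleGraph (Fin n)) (ω : Fin n → Fin m → Bool) (v : Fin n) {t j : ℕ} (h : t ≤ j) :
    (views send G ω t v).inbox j = fun _ _ => false := by
  induction t with
  | zero => rfl
  | succ t ih =>
    simp only [views]
    rw [Function.update_of_ne (by omega), ih (by omega)]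

/-- The algorithm in which every node remembers everything and sends according to `send`. -/
def fullInfo (send : ℕ → Fin n → View n b m → Fin n → (Fin b → Bool)) (T : ℕ)
    (output : Fin n → View n b m → Set (Fin n)) : Algorithm n b where
  rounds := T
  coins := m
  State := View n b m
  init _ N r := ⟨N, r, fun _ _ _ => false⟩
  send := send
  recv t _ s msg := ⟨s.nbrs, s.bits, Function.update s.inbox t msg⟩
  output := output

theorem stateAt_fullInfo (send : ℕ → Fin n → View n b m → Fin n → (Fin b → Bool)) (T : ℕ)
    (output : Fin n → View n b m → Set (Fin n)) (G : SimpleGraph (Fin n))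
    (ω : Fin n → Fin m → Bool) (t : ℕ) :
    (fullInfo send T output).stateAt G ω t = views send G ω t := by
  induction t with
  | zero => rfl
  | succ t ih =>
    funext v
    change (fullInfo send T output).recv t v ((fullInfo send T output).stateAt G ω t v)
      (fun u => send t u ((fullInfo send T output).stateAt G ω t u) v) = _
    rw [ih]
    rfl

/-- `Knows b T f`: some protocol with messages of `b` bits lets every node `v` determine
`f G ω v` after `T` rounds, on every input graph `G` and for all random bits `ω`. -/
def Knows (b T : ℕ) {X : Type}
    (f : SimpleGraph (Fin n) → (Fin n → Fin m → Bool) → Fin n → X) : Prop :=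
  ∃ (send : ℕ → Fin n → View n b m → Fin n → (Fin b → Bool)) (g : Fin n → View n b m → X),
    ∀ G ω v, g v (views send G ω T v) = f G ω v

namespace Knows

variable {T : ℕ} {X Y : Type}

theorem of_input (g : Fin n → Set (Fin n) → (Fin m → Bool) → X) :
    Knows b 0 (fun G ω v => g v (G.neighborSet v) (ω v)) :=
  ⟨fun _ _ _ _ _ => false, fun v s => g v s.nbrs s.bits, fun _ _ _ => rfl⟩

theorem map {f : SimpleGraph (Fin n) → (Fin n → Fin m → Bool) → Fin n → X} (hf : Knows b T f)
    (h : Fin n → X → Y) : Knows b T (fun G ω v => h v (f G ω v)) := by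
  obtain ⟨send, g, hg⟩ := hf
  exact ⟨send, fun v s => h v (g v s), fun G ω v => by simp only [hg]⟩

theorem congr {f f' : SimpleGraph (Fin n) → (Fin n → Fin m → Bool) → Fin n → X}
    (hf : Knows b T f) (h : ∀ G ω v, f G ω v = f' G ω v) : Knows b T f' := by
  obtain ⟨send, g, hg⟩ := hf
  exact ⟨send, g, fun G ω v => (hg G ω v).trans (h G ω v)⟩

/-- One round of communication: every node `u` computes a message for every node `v`. -/
theorem exchange {μ : Type} [Fintype μ] [Nonempty μ] (hμ : Fintype.card μ ≤ 2 ^ b)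
    {f : SimpleGraph (Fin n) → (Fin n → Fin m → Bool) → Fin n → X} (hf : Knows b T f)
    (msg : Fin n → X → Fin n → μ) :
    Knows b (T + 1) (fun G ω v => (f G ω v, fun u => msg u (f G ω u) v)) := by
  classical
  obtain ⟨send, g, hg⟩ := hf
  obtain ⟨enc⟩ : Nonempty (μ ↪ (Fin b → Bool)) :=
    Function.Embedding.nonempty_of_card_le (by simpa using hμ)
  let send' : ℕ → Fin n → View n b m → Fin n → (Fin b → Bool) := fun t u s v =>
    if t = T then enc (msg u (g u s) v) else send t u s v
  -- The state after round `T` still determines the state before it: forget the last inbox.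
  let old : View n b m → View n b m := fun s =>
    { s with inbox := Function.update s.inbox T fun _ _ => false }
  refine ⟨send', fun v s => (g v (old s), fun u => Function.invFun enc (s.inbox T u)), ?_⟩
  intro G ω v
  have hst : views send' G ω T = views send G ω T := views_congr (fun t ht => by
    funext u s v
    simp [send', ht.ne]) G ω
  refine Prod.ext ?_ ?_
  · have : old (views send' G ω (T + 1) v) = views send G ω T v := by
      simp only [old, views, Function.update_idem, hst]
      rw [← views_inbox send G ω v le_rfl, Function.update_eq_self]
    simp only [this, hg]
  · funext u
    simp only [views, Function.update_self, send', if_true, hst, hg]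
    exact Function.leftInverse_invFun enc.injective _

/-- Two rounds suffice for every node to learn the lists of `s ≤ √n` words held by `s` nodes of its
own choice, however popular these nodes are: the intermediate node with index `(a, j)` is told the
`j`-th word of every node and the `a`-th request of every node, and answers the latter. -/
theorem gather {μ : Type} [Fintype μ] [Nonempty μ] {s : ℕ} (hs : s * s ≤ n)
    (hμ : Fintype.card μ * n ≤ 2 ^ b)
    {f : SimpleGraph (Fin n) → (Fin n → Fin m → Bool) → Fin n → X} (hf : Knows b T f)
    (word : Fin n → X → Fin s → μ) (req : Fin n → X → Fin s → Fin n) :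
    Knows b (T + 2) (fun G ω v =>
      (f G ω v, fun a j => word (req v (f G ω v) a) (f G ω (req v (f G ω v) a)) j)) := by
  classical
  rcases Nat.eq_zero_or_pos n with rfl | hn
  · obtain ⟨send, g, -⟩ := hf
    exact ⟨send, fun v => v.elim0, fun _ _ v => v.elim0⟩
  have : NeZero n := ⟨hn.ne'⟩
  obtain ⟨e⟩ : Nonempty (Fin s × Fin s ↪ Fin n) :=
    Function.Embedding.nonempty_of_card_le (by simpa using hs)
  let msg₁ : Fin n → X → Fin n → μ × Fin n := fun v x p =>
    if h : ∃ q, e q = p then (word v x h.choose.2, req v x h.choose.1)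
    else (Classical.arbitrary μ, 0)
  have hm₁ : ∀ v x a j, msg₁ v x (e (a, j)) = (word v x j, req v x a) := by
    intro v x a j
    have h : ∃ q, e q = e (a, j) := ⟨_, rfl⟩
    have h' : h.choose = (a, j) := e.injective h.choose_spec
    simp only [msg₁, dif_pos h, h']
  have h₁ := hf.exchange (μ := μ × Fin n) (by simpa using hμ) msg₁
  have h₂ := h₁.exchange (μ := μ) ((Nat.le_mul_of_pos_right _ hn).trans hμ)
    (fun _ x v => (x.2 (x.2 v).2).1)
  refine (h₂.map fun _ x => (x.1.1, fun a j => x.2 (e (a, j)))).congr fun G ω v => ?_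
  simp only [hm₁]

/-- A set that every node knows after `T` rounds is the output of an algorithm with `T` rounds. -/
theorem exists_algorithm {f : SimpleGraph (Fin n) → (Fin n → Fin m → Bool) → Fin n → Set (Fin n)}
    (hf : Knows b T f) : ∃ (send : ℕ → Fin n → View n b m → Fin n → (Fin b → Bool))
      (o : Fin n → View n b m → Set (Fin n)), ∀ (G : SimpleGraph (Fin n))
      (ω : Fin n → Fin m → Bool) (v : Fin n), (fullInfo send T o).run G ω v = f G ω v := by
  obtain ⟨send, g, hg⟩ := hf
  refine ⟨send, g, fun G ω v => ?_⟩
  rw [← hg, ← stateAt_fullInfo send T g]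
  rfl

end Knows

end CongestedClique

/-! ### Truncated distance tables and their doubling -/

section Nearest

/-- A shortest path has a vertex at every intermediate distance. -/
theorem SimpleGraph.exists_edist_eq {V : Type*} {G : SimpleGraph V} {v w : V} {D i : ℕ}
    (h : G.edist v w = D) (hi : i ≤ D) :
    ∃ u, G.edist v u = i ∧ G.edist u w = (D - i : ℕ) := by
  obtain ⟨p, hp⟩ := SimpleGraph.exists_walk_of_edist_eq_coe h
  have h₁ : G.edist v (p.getVert i) ≤ i := by
    refine (SimpleGraph.edist_le (p.take i)).trans ?_
    simp
  have h₂ : G.edist (p.getVert i) w ≤ (D - i : ℕ) := by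
    refine (SimpleGraph.edist_le (p.drop i)).trans ?_
    simp [hp]
  have h₃ := G.edist_triangle (u := v) (v := p.getVert i) (w := w)
  rw [h] at h₃
  refine ⟨p.getVert i, ?_⟩
  generalize G.edist v (p.getVert i) = a at *
  generalize G.edist (p.getVert i) w = b at *
  lift a to ℕ using (h₁.trans_lt (ENat.natCast_lt_top i)).ne
  lift b to ℕ using (h₂.trans_lt (ENat.natCast_lt_top _)).ne
  norm_cast at *
  omega

theorem SimpleGraph.edist_lt_card {V : Type*} [Fintype V] {G : SimpleGraph V} {v w : V}
    (h : G.edist v w ≠ ⊤) : G.edist v w < Fintype.card V := by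
  have hr := SimpleGraph.reachable_of_edist_ne_top h
  obtain ⟨p, hp, hl⟩ := hr.exists_path_of_dist
  rw [← hr.coe_dist_eq_edist, ← hl]
  exact_mod_cast hp.length_lt

open Finset Classical in
/-- The vertices that precede `w` when vertices are sorted by `δ`, ties broken by the order
of `V`. -/
noncomputable def before {V : Type*} [Fintype V] [LinearOrder V] (δ : V → ℕ∞) (w : V) : Finset V :=
  univ.filter fun x => toLex (δ x, x) < toLex (δ w, w)

open Classical in
/-- Keep only the `s` smallest entries of `δ`, and replace the others by `⊤`. -/
noncomputable def truncate {V : Type*} [Fintype V] [LinearOrder V] (s : ℕ) (δ : V → ℕ∞) (w : V) :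
    ℕ∞ :=
  if (before δ w).card < s then δ w else ⊤

/-- `w` is one of the `s` vertices nearest to `v`, and within distance `R`. -/
def IsNear {V : Type*} [Fintype V] [LinearOrder V] (G : SimpleGraph V) (s R : ℕ) (v w : V) : Prop :=
  G.edist v w ≤ R ∧ (before (G.edist v) w).card < s

open Classical in
/-- The distances from `v` to the `s` nearest vertices within distance `R`; all other entries
are `⊤`. -/
noncomputable def nearDist {V : Type*} [Fintype V] [LinearOrder V] (G : SimpleGraph V) (s R : ℕ)
    (v w : V) : ℕ∞ :=
  if IsNear G s R v w then G.edist v w else ⊤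

variable {V : Type*} [Fintype V] [LinearOrder V] {G : SimpleGraph V} {s R : ℕ} {v w x u : V}

theorem mem_before {δ : V → ℕ∞} : x ∈ before δ w ↔ toLex (δ x, x) < toLex (δ w, w) := by
  simp [before]

theorem toLex_le_of_mem_before {δ : V → ℕ∞} (h : x ∈ before δ w) : δ x ≤ δ w := by
  rw [mem_before, Prod.Lex.toLex_lt_toLex] at h
  rcases h with h | h
  · exact h.le
  · exact h.1.le

theorem before_subset_before {δ : V → ℕ∞} (h : toLex (δ x, x) ≤ toLex (δ w, w)) :
    before δ x ⊆ before δ w := fun y hy => by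
  rw [mem_before] at hy ⊢
  exact hy.trans_le h

theorem nearDist_of_isNear (h : IsNear G s R v w) : nearDist G s R v w = G.edist v w := if_pos h

theorem isNear_of_nearDist_ne_top (h : nearDist G s R v w ≠ ⊤) : IsNear G s R v w := by
  by_contra h'
  exact h (if_neg h')

theorem edist_le_nearDist : G.edist v w ≤ nearDist G s R v w := by
  by_cases h : IsNear G s R v w
  · rw [nearDist_of_isNear h]
  · simp [nearDist, h]

theorem isNear_self (hs : 0 < s) : IsNear G s R v v := by
  refine ⟨by simp, ?_⟩
  have : before (G.edist v) v = ∅ := by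
    ext x
    simp only [mem_before, Prod.Lex.toLex_lt_toLex, SimpleGraph.edist_self, Finset.notMem_empty,
      iff_false, not_or, not_and]
    refine ⟨by simp, fun h => ?_⟩
    rw [SimpleGraph.edist_eq_zero_iff.1 h]
    exact lt_irrefl _
  simpa [this] using hs

/-- If at least `s` vertices precede `w`, then at least `s` of those that precede `w` have fewer
than `s` predecessors: consider the first vertex with at least `s` predecessors. -/
theorem le_card_filter_before {δ : V → ℕ∞} (h : s ≤ (before δ w).card) :
    s ≤ ((before δ w).filter fun x => (before δ x).card < s).card := by
  classical
  obtain ⟨x, hx, hmin⟩ := Finset.exists_min_image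
    (Finset.univ.filter fun x => s ≤ (before δ x).card) (fun x => toLex (δ x, x)) ⟨w, by simpa⟩
  simp only [Finset.mem_filter, Finset.mem_univ, true_and] at hx hmin
  refine hx.trans (Finset.card_le_card fun y hy => ?_)
  refine Finset.mem_filter.2 ⟨before_subset_before (hmin w h) hy, ?_⟩
  by_contra! hy'
  exact (hmin y hy').not_gt (mem_before.1 hy)

/-- Truncation of any upper estimate of the distances from `v` that is exact on the nearest
vertices, and finite only within distance `R`, yields the table of nearest vertices. -/
theorem truncate_eq_nearDist {δ : V → ℕ∞} (hle : ∀ x, G.edist v x ≤ δ x)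
    (heq : ∀ x, IsNear G s R v x → δ x = G.edist v x) (htop : ∀ x, δ x ≠ ⊤ → G.edist v x ≤ R) :
    truncate s δ = nearDist G s R v := by
  have hkey : ∀ x, toLex (G.edist v x, x) ≤ toLex (δ x, x) := fun x => by
    rw [Prod.Lex.toLex_le_toLex]
    rcases (hle x).lt_or_eq with h | h
    · exact Or.inl h
    · exact Or.inr ⟨h, le_rfl⟩
  funext w
  by_cases hw : IsNear G s R v w
  · have hsub : before δ w ⊆ before (G.edist v) w := fun x hx => by
      rw [mem_before] at hx ⊢
      rw [heq w hw] at hx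
      exact (hkey x).trans_lt hx
    rw [nearDist_of_isNear hw, truncate, if_pos ((Finset.card_le_card hsub).trans_lt hw.2),
      heq w hw]
  · rw [nearDist, if_neg hw, truncate]
    split_ifs with hc
    · by_contra hne
      have hR := htop w hne
      have hs : s ≤ (before (G.edist v) w).card := by
        by_contra! h
        exact hw ⟨hR, h⟩
      have hsub : ((before (G.edist v) w).filter fun x => (before (G.edist v) x).card < s) ⊆
          before δ w := fun x hx => by
        obtain ⟨hx, hxs⟩ := Finset.mem_filter.1 hx
        have hnear : IsNear G s R v x := ⟨(toLex_le_of_mem_before hx).trans hR, hxs⟩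
        rw [mem_before] at hx ⊢
        rw [heq x hnear]
        exact hx.trans_le (hkey w)
      exact (hc.trans_le ((le_card_filter_before hs).trans (Finset.card_le_card hsub))).false
    · rfl

/-- The table for distance one only depends on the neighbours of `v`. -/
theorem truncate_neighborSet (v : V) (δ : V → ℕ∞) (h₀ : δ v = 0)
    (h₁ : ∀ x ∈ G.neighborSet v, δ x = 1) (h₂ : ∀ x, x ≠ v → x ∉ G.neighborSet v → δ x = ⊤) : truncate s δ = nearDist G s 1 v := by
  have key : ∀ x, δ x = G.edist v x ∧ G.edist v x ≤ 1 ∨ δ x = ⊤ ∧ ¬ G.edist v x ≤ 1 := fun x => by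
    by_cases hx : x = v
    · subst hx
      simp [h₀]
    · by_cases hxv : x ∈ G.neighborSet v
      · have := SimpleGraph.edist_eq_one_iff_adj.2 hxv
        simp [h₁ x hxv, this]
      · refine Or.inr ⟨h₂ x hx hxv, ?_⟩
        rw [SimpleGraph.edist_le_one_iff_adj_or_eq]
        rintro (h | h)
        · exact hxv h
        · exact hx h.symm
  refine truncate_eq_nearDist (fun x => ?_) (fun x hx => ?_) fun x hx => ?_
  · rcases key x with h | h <;> simp [h.1]
  · rcases key x with h | h
    · exact h.1
    · exact absurd (by simpa using hx.1) h.2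
  · rcases key x with h | h
    · simpa using h.2
    · exact absurd h.1 hx

/-- A vertex half way to a near vertex is near, and the latter is near for it. -/
theorem IsNear.exists_midpoint (h : IsNear G s (2 * R) v w) (hvw : w ≠ v) :
    ∃ u, u ≠ v ∧ IsNear G s R v u ∧ IsNear G s R u w ∧
      G.edist v u + G.edist u w = G.edist v w := by
  obtain ⟨D, hD⟩ := ENat.ne_top_iff_exists.1 (h.1.trans_lt (ENat.natCast_lt_top _)).ne
  have hD0 : D ≠ 0 := by
    rintro rfl
    exact hvw (SimpleGraph.edist_eq_zero_iff.1 hD.symm).symm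
  have hR : D ≤ 2 * R := by
    have := h.1
    rw [← hD] at this
    exact_mod_cast this
  obtain ⟨u, hu, hu'⟩ := SimpleGraph.exists_edist_eq hD.symm (i := D - D / 2) (by omega)
  have hadd : G.edist v u + G.edist u w = G.edist v w := by
    rw [hu, hu', ← hD]
    norm_cast
    omega
  refine ⟨u, ?_, ⟨?_, ?_⟩, ⟨?_, ?_⟩, hadd⟩
  · rintro rfl
    rw [SimpleGraph.edist_self] at hu
    norm_cast at hu
    omega
  · rw [hu]
    norm_cast
    omega
  · refine (Finset.card_le_card (before_subset_before ?_)).trans_lt h.2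
    rw [Prod.Lex.toLex_le_toLex]
    by_cases h0 : D / 2 = 0
    · have : u = w := by
        rw [← SimpleGraph.edist_eq_zero_iff (G := G), hu']
        norm_cast
        omega
      simp [this]
    · left
      simp only
      rw [hu, ← hD]
      norm_cast
      omega
  · rw [hu']
    norm_cast
    omega
  · refine (Finset.card_le_card fun y hy => ?_).trans_lt h.2
    rw [mem_before, Prod.Lex.toLex_lt_toLex] at hy ⊢
    have hne : G.edist v u ≠ ⊤ := by simp [hu]
    rcases hy with hy | hy
    · left
      refine (G.edist_triangle (v := u)).trans_lt ?_
      simp only at hy ⊢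
      rw [← hadd]
      exact (ENat.add_lt_add_iff_left hne).2 hy
    · have hle : G.edist v y ≤ G.edist v w := by
        rw [← hadd, ← show G.edist u y = G.edist u w from hy.1]
        exact G.edist_triangle
      rcases hle.lt_or_eq with h | h
      · exact Or.inl h
      · exact Or.inr ⟨h, hy.2⟩

/-- The nearest vertices within distance `2 * R` are found by a truncated min-plus product of the
tables for distance `R`. -/
theorem truncate_iInf_nearDist (hs : 0 < s) (v : V) :
    truncate s (fun w => ⨅ u, nearDist G s R v u + nearDist G s R u w) =
      nearDist G s (2 * R) v := by
  have : Nonempty V := ⟨v⟩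
  refine truncate_eq_nearDist (fun w => le_iInf fun u => ?_) (fun w hw => le_antisymm ?_ ?_)
    fun w hw => ?_
  · exact G.edist_triangle.trans (add_le_add edist_le_nearDist edist_le_nearDist)
  · by_cases hwv : w = v
    · subst hwv
      refine (iInf_le _ w).trans ?_
      simp [nearDist_of_isNear (isNear_self hs)]
    · obtain ⟨u, -, h₁, h₂, h₃⟩ := hw.exists_midpoint hwv
      refine (iInf_le _ u).trans ?_
      rw [nearDist_of_isNear h₁, nearDist_of_isNear h₂, h₃]
  · exact le_iInf fun u =>
      G.edist_triangle.trans (add_le_add edist_le_nearDist edist_le_nearDist)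
  · obtain ⟨u, hu⟩ :=
      exists_eq_ciInf_of_finite (f := fun u => nearDist G s R v u + nearDist G s R u w)
    rw [← hu] at hw
    obtain ⟨h₁, h₂⟩ := WithTop.add_ne_top.1 hw
    have h₁ := (isNear_of_nearDist_ne_top h₁).1
    have h₂ := (isNear_of_nearDist_ne_top h₂).1
    refine G.edist_triangle.trans ((add_le_add h₁ h₂).trans ?_)
    push_cast
    rw [two_mul]

/-- `h` maps every near vertex `w ≠ v` to the next vertex of a shortest path from `v` to `w`. -/
def IsNextHop (G : SimpleGraph V) (s R : ℕ) (v : V) (h : V → V) : Prop :=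
  ∀ w, w ≠ v → IsNear G s R v w → G.Adj v (h w) ∧ G.edist (h w) w + 1 = G.edist v w

theorem isNextHop_one : IsNextHop G s 1 v id := by
  intro w hwv hw
  have h : G.Adj v w := by
    have := SimpleGraph.edist_le_one_iff_adj_or_eq.1 (by simpa using hw.1)
    exact this.resolve_right fun h => hwv h.symm
  simp [h, SimpleGraph.edist_eq_one_iff_adj.2 h]

/-- The next hop towards a midpoint is a next hop towards the target. -/
theorem IsNextHop.comp {h : V → V} (hh : IsNextHop G s R v h) {mid : V → V}
    (hmid : ∀ w, w ≠ v → IsNear G s (2 * R) v w → mid w ≠ v ∧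
      nearDist G s R v (mid w) + nearDist G s R (mid w) w = nearDist G s (2 * R) v w) :
    IsNextHop G s (2 * R) v fun w => h (mid w) := by
  intro w hwv hw
  obtain ⟨hm, heq⟩ := hmid w hwv hw
  rw [nearDist_of_isNear hw] at heq
  have hfin : G.edist v w ≠ ⊤ := (hw.1.trans_lt (ENat.natCast_lt_top _)).ne
  rw [← heq] at hfin
  obtain ⟨h₁, h₂⟩ := WithTop.add_ne_top.1 hfin
  have h₁ := isNear_of_nearDist_ne_top h₁
  have h₂ := isNear_of_nearDist_ne_top h₂
  rw [nearDist_of_isNear h₁, nearDist_of_isNear h₂] at heq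
  obtain ⟨hadj, hd⟩ := hh (mid w) hm h₁
  refine ⟨hadj, le_antisymm ?_ ?_⟩
  · rw [← heq, ← hd, add_right_comm]
    gcongr
    exact G.edist_triangle
  · refine (G.edist_triangle (v := h (mid w))).trans ?_
    rw [SimpleGraph.edist_eq_one_iff_adj.2 hadj, add_comm]

theorem card_isNear_le [DecidablePred (IsNear G s R v)] :
    (Finset.univ.filter (IsNear G s R v)).card ≤ s := by
  classical
  by_contra! hc
  -- The last near vertex is preceded by all other near vertices.
  obtain ⟨w, hw, hmax⟩ := Finset.exists_max_image (Finset.univ.filter (IsNear G s R v))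
    (fun x => toLex (G.edist v x, x)) (Finset.card_pos.1 (by omega))
  have hsub : (Finset.univ.filter (IsNear G s R v)).erase w ⊆ before (G.edist v) w := by
    intro y hy
    obtain ⟨hyw, hy⟩ := Finset.mem_erase.1 hy
    rw [mem_before]
    refine (hmax y hy).lt_of_ne fun h => hyw ?_
    simpa using congrArg (fun z => (ofLex z).2) h
  have := Finset.card_le_card hsub
  rw [Finset.card_erase_of_mem hw] at this
  have := ((Finset.mem_filter.1 hw).2).2
  omega

end Nearest

namespace CongestedClique

/-- A table with at most `s` finite entries, all of them below `n`, is a list of `s` words. -/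
theorem exists_table_coding (n s : ℕ) :
    ∃ (enc : (Fin n → ℕ∞) → Fin s → Option (Fin n × Fin n))
      (dec : (Fin s → Option (Fin n × Fin n)) → Fin n → ℕ∞)
      (elt : (Fin n → ℕ∞) → Fin s → Option (Fin n)),
      ∀ δ : Fin n → ℕ∞, {w | δ w ≠ ⊤}.ncard ≤ s → (∀ w, δ w ≠ ⊤ → δ w < n) →
        dec (enc δ) = δ ∧ ∀ w, δ w ≠ ⊤ → ∃ j, elt δ j = some w := by
  classical
  let lst : (Fin n → ℕ∞) → List (Fin n) := fun δ => (Finset.univ.filter fun w => δ w ≠ ⊤).toList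
  let elt : (Fin n → ℕ∞) → Fin s → Option (Fin n) := fun δ j => (lst δ)[(j : ℕ)]?
  let enc : (Fin n → ℕ∞) → Fin s → Option (Fin n × Fin n) := fun δ j =>
    (elt δ j).bind fun w => if h : (δ w).toNat < n then some (w, ⟨_, h⟩) else none
  let D : Set (Fin n → ℕ∞) := {δ | {w | δ w ≠ ⊤}.ncard ≤ s ∧ ∀ w, δ w ≠ ⊤ → δ w < n}
  have helt : ∀ δ ∈ D, ∀ w, δ w ≠ ⊤ → ∃ j, elt δ j = some w := by
    intro δ hδ w hw
    have hmem : w ∈ lst δ := by simpa [lst] using hw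
    obtain ⟨j, hj⟩ := List.mem_iff_getElem?.1 hmem
    have hlen : (lst δ).length ≤ s := by
      have := hδ.1
      rw [Set.ncard_eq_toFinset_card'] at this
      simpa [lst] using this
    have hjl : j < (lst δ).length := by
      by_contra! h
      rw [List.getElem?_eq_none h] at hj
      cases hj
    exact ⟨⟨j, hjl.trans_le hlen⟩, hj⟩
  have key : ∀ δ ∈ D, ∀ δ', enc δ = enc δ' → ∀ w, δ w ≠ ⊤ → δ' w ≠ ⊤ ∧ δ w = δ' w := by
    intro δ hδ δ' h w hw
    obtain ⟨j, hj⟩ := helt δ hδ w hw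
    have hlt : (δ w).toNat < n := by
      have := hδ.2 w hw
      rwa [← ENat.natCast_toNat hw, Nat.cast_lt] at this
    have h1 : enc δ j = some (w, ⟨_, hlt⟩) := by simp [enc, hj, hlt]
    rw [h] at h1
    simp only [enc, Option.bind_eq_some_iff] at h1
    obtain ⟨w', hw', h2⟩ := h1
    split_ifs at h2 with h3
    simp only [Option.some.injEq, Prod.mk.injEq, Fin.mk.injEq] at h2
    obtain ⟨rfl, h2⟩ := h2
    have hne : δ' w' ≠ ⊤ := by
      have := List.mem_iff_getElem?.2 ⟨_, hw'⟩
      simpa [lst] using this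
    exact ⟨hne, by rw [← ENat.natCast_toNat hw, ← ENat.natCast_toNat hne, h2]⟩
  have hinj : Set.InjOn enc D := by
    intro δ hδ δ' hδ' h
    funext w
    by_cases hw : δ w = ⊤
    · by_cases hw' : δ' w = ⊤
      · rw [hw, hw']
      · exact absurd hw (key δ' hδ' δ h.symm w hw').1
    · exact (key δ hδ δ' h w hw).2
  exact ⟨enc, Function.invFunOn enc D, elt, fun δ h₁ h₂ =>
    ⟨hinj.leftInvOn_invFunOn ⟨h₁, h₂⟩, helt δ ⟨h₁, h₂⟩⟩⟩

variable {n m b T : ℕ}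

theorem views_nbrs_bits (send : ℕ → Fin n → View n b m → Fin n → (Fin b → Bool))
    (G : SimpleGraph (Fin n)) (ω : Fin n → Fin m → Bool) (t : ℕ) (v : Fin n) :
    (views send G ω t v).nbrs = G.neighborSet v ∧ (views send G ω t v).bits = ω v := by
  induction t with
  | zero => exact ⟨rfl, rfl⟩
  | succ t ih => exact ih

theorem Knows.with_input {X : Type} {f : SimpleGraph (Fin n) → (Fin n → Fin m → Bool) → Fin n → X}
    (hf : Knows b T f) : Knows b T (fun G ω v => (f G ω v, G.neighborSet v, ω v)) := by
  obtain ⟨send, g, hg⟩ := hf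
  refine ⟨send, fun v x => (g v x, x.nbrs, x.bits), fun G ω v => ?_⟩
  simp only [hg, views_nbrs_bits]

theorem ncard_nearDist_ne_top_le (G : SimpleGraph (Fin n)) (s R : ℕ) (v : Fin n) :
    {w | nearDist G s R v w ≠ ⊤}.ncard ≤ s := by
  classical
  refine le_trans ?_ (card_isNear_le (G := G) (s := s) (R := R) (v := v))
  rw [← Set.ncard_coe_finset]
  refine Set.ncard_le_ncard (fun w hw => ?_) (Set.toFinite _)
  simpa using isNear_of_nearDist_ne_top hw

theorem nearDist_lt (G : SimpleGraph (Fin n)) (s R : ℕ) (v w : Fin n)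
    (h : nearDist G s R v w ≠ ⊤) : nearDist G s R v w < n := by
  have hn := nearDist_of_isNear (isNear_of_nearDist_ne_top h)
  rw [hn] at h ⊢
  simpa using SimpleGraph.edist_lt_card h

/-- Doubling the radius `j` times, in two rounds each, every node learns its `s` nearest nodes
within distance `2 ^ j`, their distances and the next hops towards them. -/
theorem knows_nearDist {s : ℕ} (hs : 0 < s) (hsn : s * s ≤ n) (hb : (n * n + 1) * n ≤ 2 ^ b)
    (j : ℕ) :
    ∃ h : SimpleGraph (Fin n) → (Fin n → Fin m → Bool) → Fin n → Fin n → Fin n,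
      (∀ G ω v, IsNextHop G s (2 ^ j) v (h G ω v)) ∧
      Knows b (2 * j) (fun G ω v => (nearDist G s (2 ^ j) v, h G ω v)) := by
  classical
  induction j with
  | zero =>
    refine ⟨fun _ _ _ => id, fun G ω v => isNextHop_one, ?_⟩
    refine (Knows.of_input fun v N _ =>
      (truncate s (fun x => if x = v then 0 else if x ∈ N then 1 else ⊤), id)).congr
      fun G ω v => ?_
    refine Prod.ext ?_ rfl
    refine truncate_neighborSet v _ (by simp) (fun x hx => ?_) (fun x hx hx' => ?_)
    · have : x ≠ v := (G.ne_of_adj hx).symm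
      rw [if_neg this, if_pos hx]
    · rw [if_neg hx, if_neg hx']
  | succ j ih =>
    obtain ⟨h, hh, hK⟩ := ih
    obtain ⟨enc, dec, elt, hcode⟩ := exists_table_coding n s
    have hcode : ∀ G R v, dec (enc (nearDist G s R v)) = nearDist G s R v ∧
        ∀ w, nearDist G s R v w ≠ ⊤ → ∃ j, elt (nearDist G s R v) j = some w := fun G R v =>
      hcode _ (ncard_nearDist_ne_top_le G s R v) (nearDist_lt G s R v)
    let req : Fin n → (Fin n → ℕ∞) × (Fin n → Fin n) → Fin s → Fin n := fun v x a =>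
      (elt x.1 a).getD v
    have hK₂ := hK.gather (μ := Option (Fin n × Fin n)) hsn (by simpa using hb)
      (fun _ x => enc x.1) req
    -- The table of `u`, as far as `v` knows it.
    let tab : Fin n → (((Fin n → ℕ∞) × (Fin n → Fin n)) ×
        (Fin s → Fin s → Option (Fin n × Fin n))) → Fin n → Fin n → ℕ∞ := fun v y u =>
      if ha : ∃ a, req v y.1 a = u then dec (y.2 ha.choose) else fun _ => ⊤
    let est : Fin n → (((Fin n → ℕ∞) × (Fin n → Fin n)) ×
        (Fin s → Fin s → Option (Fin n × Fin n))) → Fin n → Fin n → ℕ∞ := fun v y w u =>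
      y.1.1 u + tab v y u w
    let mid : Fin n → (((Fin n → ℕ∞) × (Fin n → Fin n)) ×
        (Fin s → Fin s → Option (Fin n × Fin n))) → Fin n → Fin n := fun v y w =>
      if hu : ∃ u, u ≠ v ∧ est v y w u = ⨅ u, est v y w u then hu.choose else v
    let know : SimpleGraph (Fin n) → (Fin n → Fin m → Bool) → Fin n →
        (((Fin n → ℕ∞) × (Fin n → Fin n)) × (Fin s → Fin s → Option (Fin n × Fin n))) :=
      fun G ω v => ((nearDist G s (2 ^ j) v, h G ω v), fun a i =>
        enc (nearDist G s (2 ^ j) (req v (nearDist G s (2 ^ j) v, h G ω v) a)) i)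
    have hest : ∀ G ω v w, est v (know G ω v) w = fun u =>
        nearDist G s (2 ^ j) v u + nearDist G s (2 ^ j) u w := by
      intro G ω v w
      funext u
      by_cases hu : nearDist G s (2 ^ j) v u = ⊤
      · simp [est, know, hu]
      · have ha : ∃ a, req v (know G ω v).1 a = u := by
          obtain ⟨a, ha⟩ := (hcode G (2 ^ j) v).2 u hu
          exact ⟨a, by simp [req, know, ha]⟩
        have htab : tab v (know G ω v) u = nearDist G s (2 ^ j) u := by
          simp only [tab, dif_pos ha]
          have hreq : req v (nearDist G s (2 ^ j) v, h G ω v) ha.choose = u := ha.choose_spec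
          change dec (enc (nearDist G s (2 ^ j)
            (req v (nearDist G s (2 ^ j) v, h G ω v) ha.choose))) = _
          rw [hreq, (hcode G (2 ^ j) u).1]
        simp only [est, htab, know]
    have htrunc : ∀ G ω v, truncate s (fun w => ⨅ u, est v (know G ω v) w u) =
        nearDist G s (2 ^ (j + 1)) v := fun G ω v => by
      simp only [hest]
      rw [truncate_iInf_nearDist hs, pow_succ']
    refine ⟨fun G ω v w => h G ω v (mid v (know G ω v) w), fun G ω v => ?_, ?_⟩
    · rw [pow_succ']
      refine (hh G ω v).comp fun w hwv hw => ?_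
      obtain ⟨u, huv, hu₁, hu₂, hu⟩ := hw.exists_midpoint hwv
      have hiInf : ⨅ u, est v (know G ω v) w u = nearDist G s (2 * 2 ^ j) v w := by
        have hfin : nearDist G s (2 * 2 ^ j) v w ≠ ⊤ := by
          rw [nearDist_of_isNear hw]
          exact (hw.1.trans_lt (ENat.natCast_lt_top _)).ne
        rw [← truncate_iInf_nearDist hs v] at hfin ⊢
        simp only [hest]
        simp only [truncate] at hfin ⊢
        split_ifs at hfin ⊢
        · rfl
        · exact absurd rfl hfin
      have hex : ∃ u, u ≠ v ∧ est v (know G ω v) w u = ⨅ u, est v (know G ω v) w u := by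
        refine ⟨u, huv, ?_⟩
        rw [hiInf, nearDist_of_isNear hw, hest]
        simp only [nearDist_of_isNear hu₁, nearDist_of_isNear hu₂, hu]
      have hmid : mid v (know G ω v) w = hex.choose := dif_pos hex
      rw [hmid]
      exact ⟨hex.choose_spec.1,
        (congrFun (hest G ω v w) _).symm.trans (hex.choose_spec.2.trans hiInf)⟩
    · refine (hK₂.map fun v y =>
        (truncate s (fun w => ⨅ u, est v y w u), fun w => y.1.2 (mid v y w))).congr fun G ω v => ?_
      exact Prod.ext (htrunc G ω v) rfl

end CongestedClique

/-! ### Clusters and the spanner they define -/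

section Clusters

variable {V : Type*} [LinearOrder V] {G : SimpleGraph V}

/-- `x` is the vertex of `A` nearest to `v`, ties broken by the order of `V`, and it lies within
distance `i` of `v`. -/
def IsCenter (G : SimpleGraph V) (A : Set V) (i : ℕ) (v x : V) : Prop :=
  x ∈ A ∧ G.edist v x ≤ i ∧ ∀ y ∈ A, toLex (G.edist v x, x) ≤ toLex (G.edist v y, y)

/-- Clusters are closed under taking the next vertex on a shortest path to the center. -/
theorem IsCenter.of_edist_add_one {A : Set V} {i : ℕ} {v p x : V} (h : IsCenter G A i v x)
    (hvp : G.Adj v p) (hp : G.edist p x + 1 = G.edist v x) : IsCenter G A i p x := by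
  obtain ⟨hxA, hxi, hmin⟩ := h
  have hfin : G.edist v x ≠ ⊤ := (hxi.trans_lt (ENat.natCast_lt_top i)).ne
  refine ⟨hxA, le_trans ?_ hxi, fun y hy => ?_⟩
  · rw [← hp]
    exact le_self_add
  by_contra! hlt
  refine (hmin y hy).not_gt ?_
  have htri : G.edist v y ≤ G.edist p y + 1 := by
    refine (G.edist_triangle (v := p)).trans ?_
    rw [SimpleGraph.edist_eq_one_iff_adj.2 hvp, add_comm]
  rw [Prod.Lex.toLex_lt_toLex] at hlt ⊢
  rcases hlt with hlt | hlt
  · left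
    refine htri.trans_lt ?_
    simp only
    rw [← hp]
    exact (ENat.add_lt_add_iff_right ENat.one_ne_top).2 hlt
  · have : G.edist v y ≤ G.edist v x := by
      rw [← hp, ← show G.edist p y = G.edist p x from hlt.1]
      exact htri
    rcases this.lt_or_eq with h | h
    · exact Or.inl h
    · exact Or.inr ⟨h, hlt.2⟩

variable [Fintype V]

open Classical in
/-- The element of `A` with the smallest entry in the table `δ`, if that entry is at most `i`. -/
noncomputable def center (δ : V → ℕ∞) (A : Set V) (i : ℕ) : Option V :=
  if h : ∃ x ∈ A, δ x ≤ i ∧ ∀ y ∈ A, toLex (δ x, x) ≤ toLex (δ y, y) then some h.choose else none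

theorem center_eq_some_iff {δ : V → ℕ∞} {A : Set V} {i : ℕ} {x : V} : center δ A i = some x ↔
    x ∈ A ∧ δ x ≤ i ∧ ∀ y ∈ A, toLex (δ x, x) ≤ toLex (δ y, y) := by
  constructor
  · intro h
    unfold center at h
    split_ifs at h with hx
    rw [Option.some.injEq] at h
    exact h ▸ hx.choose_spec
  · intro h
    have hx : ∃ x ∈ A, δ x ≤ i ∧ ∀ y ∈ A, toLex (δ x, x) ≤ toLex (δ y, y) := ⟨x, h⟩
    rw [center, dif_pos hx, Option.some.injEq]
    have := le_antisymm (hx.choose_spec.2.2 x h.1) (h.2.2 _ hx.choose_spec.1)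
    simpa using congrArg (fun z => (ofLex z).2) this

/-- If `A` meets every long initial segment of the vertices sorted by their distance from `v`, the
table of the vertices near `v` determines the center of `v`. -/
theorem center_nearDist {s R i : ℕ} {v x : V} {A : Set V}
    (hit : ∀ w, s ≤ (before (G.edist v) w).card → ∃ y ∈ before (G.edist v) w, y ∈ A)
    (hi : i ≤ R) : center (nearDist G s R v) A i = some x ↔ IsCenter G A i v x := by
  rw [center_eq_some_iff]
  constructor
  · rintro ⟨hxA, hxi, hmin⟩
    have hx : IsNear G s R v x :=
      isNear_of_nearDist_ne_top (hxi.trans_lt (ENat.natCast_lt_top i)).ne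
    rw [nearDist_of_isNear hx] at hxi hmin
    refine ⟨hxA, hxi, fun y hy => ?_⟩
    by_contra! hlt
    have hyx : y ∈ before (G.edist v) x := mem_before.2 hlt
    have hy' : IsNear G s R v y := ⟨(toLex_le_of_mem_before hyx).trans hx.1,
      (Finset.card_le_card (before_subset_before hlt.le)).trans_lt hx.2⟩
    have := hmin y hy
    rw [nearDist_of_isNear hy'] at this
    exact this.not_gt hlt
  · rintro ⟨hxA, hxi, hmin⟩
    have hx : IsNear G s R v x := by
      refine ⟨hxi.trans (by exact_mod_cast hi), ?_⟩
      by_contra! hs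
      obtain ⟨y, hy, hyA⟩ := hit x hs
      exact (hmin y hyA).not_gt (mem_before.1 hy)
    rw [nearDist_of_isNear hx]
    refine ⟨hxA, hxi, fun y hy => (hmin y hy).trans ?_⟩
    rw [Prod.Lex.toLex_le_toLex]
    rcases (edist_le_nearDist (G := G) (s := s) (R := R) (v := v) (w := y)).lt_or_eq with h | h
    · exact Or.inl h
    · exact Or.inr ⟨h, le_rfl⟩

theorem exists_isCenter {A : Set V} {i : ℕ} {v x : V} (hx : x ∈ A) (hxi : G.edist v x ≤ i) :
    ∃ y, IsCenter G A i v y := by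
  classical
  obtain ⟨y, hy, hmin⟩ := Finset.exists_min_image (Finset.univ.filter (· ∈ A))
    (fun y => toLex (G.edist v y, y)) ⟨x, by simpa⟩
  simp only [Finset.mem_filter, Finset.mem_univ, true_and] at hy hmin
  refine ⟨y, hy, le_trans ?_ hxi, hmin⟩
  have := hmin x hx
  rw [Prod.Lex.toLex_le_toLex] at this
  rcases this with h | h
  · exact h.le
  · exact h.1.le

end Clusters

section ClusterSpanner

variable {V : Type*}

open Classical in
/-- A member of `N` with label `x`, if there is one. -/
noncomputable def pick (N : Set V) (label : V → Option V) (x : V) : Option V :=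
  if h : ∃ u ∈ N, label u = some x then some h.choose else none

theorem pick_spec {N : Set V} {label : V → Option V} {x u : V} (h : pick N label x = some u) :
    u ∈ N ∧ label u = some x := by
  unfold pick at h
  split_ifs at h with hx
  rw [Option.some.injEq] at h
  exact h ▸ hx.choose_spec

theorem exists_pick {N : Set V} {label : V → Option V} {x u : V} (hu : u ∈ N)
    (hx : label u = some x) : ∃ w, pick N label x = some w :=
  ⟨_, dif_pos ⟨u, hu, hx⟩⟩

theorem ncard_pick_le [Finite V] (N : Set V) (label : V → Option V) (P : V → Prop) :
    {u | ∃ x, pick N label x = some u ∧ P x}.ncard ≤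
      {x | (∃ u ∈ N, label u = some x) ∧ P x}.ncard := by
  refine (Set.ncard_le_ncard (t := (fun x => (pick N label x).getD x) ''
    {x | (∃ u ∈ N, label u = some x) ∧ P x}) ?_ (Set.toFinite _)).trans
    (Set.ncard_image_le (Set.toFinite _))
  rintro u ⟨x, hu, hP⟩
  exact ⟨x, ⟨⟨u, pick_spec hu⟩, hP⟩, by simp [hu]⟩

/-- The first level `i ≤ d'` such that `v` is in no cluster of level `i + 1`, or `d'` if there is
none. -/
noncomputable def level (C : ℕ → V → Option V) (d' : ℕ) (v : V) : ℕ :=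
  sInf {i | i = d' ∨ C (i + 1) v = none}

theorem level_le (C : ℕ → V → Option V) (d' : ℕ) (v : V) : level C d' v ≤ d' :=
  Nat.sInf_le (Or.inl rfl)

theorem eq_none_of_level_lt {C : ℕ → V → Option V} {d' : ℕ} {v : V} (h : level C d' v < d') :
    C (level C d' v + 1) v = none := by
  have : level C d' v ∈ {i | i = d' ∨ C (i + 1) v = none} := Nat.sInf_mem ⟨d', Or.inl rfl⟩
  exact this.resolve_left h.ne

theorem exists_of_le_level {C : ℕ → V → Option V} {d' : ℕ} {v : V} (h₀ : ∃ x, C 0 v = some x)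
    {i : ℕ} (hi : i ≤ level C d' v) : ∃ x, C i v = some x := by
  cases i with
  | zero => exact h₀
  | succ i =>
    have := Nat.notMem_of_lt_sInf (Nat.lt_of_succ_le hi)
    simp only [Set.mem_ofPred_eq, not_or] at this
    exact Option.ne_none_iff_exists'.1 this.2

/-- The edges at `v` that lead to the centers `C i v` of its clusters; `hop x` is the next vertex on
a path to `x`. -/
def treeEdges (C : ℕ → V → Option V) (hop : V → V) (d' : ℕ) (v : V) : Set V :=
  {u | ∃ i ≤ d', ∃ x, C i v = some x ∧ x ≠ v ∧ u = hop x}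

/-- The edges at a vertex with neighbours `N` and level `l < d'`: one to every adjacent cluster
of level `l`. -/
def levelEdges (N : Set V) (label : V → Option V) (l d' : ℕ) : Set V :=
  {u | ∃ x, pick N label x = some u ∧ l < d'}

open Classical in
/-- What `v`, a vertex with neighbours `N` that belongs to the cluster `c` of level `d'`, offers to
the center `x` of level `d`: an edge between the clusters of `c` and of `x`, if `v` has one. -/
noncomputable def offer (N : Set V) (label : V → Option V) (c : Option V) (x : V) : Option V :=
  if (pick N label x).isSome then c else none

/-- A center accepts the offer of `v` if `v` is the one it picks among all vertices of the same
cluster. -/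
def Accepts (offers : V → Option V) (v : V) : Prop :=
  ∃ y, offers v = some y ∧ pick Set.univ offers y = some v

/-- The edges at `v` to clusters of level `d` whose centers accept the offer of `v`. -/
def topEdges (N : Set V) (label : V → Option V) (accepted : V → Prop) : Set V :=
  {u | ∃ x, pick N label x = some u ∧ accepted x}

/-- The neighbours of `v` selected by `v`. -/
def selected (G : SimpleGraph V) (C : ℕ → V → Option V) (hop : V → V → V) (d d' : ℕ) (v : V) :
    Set V :=
  treeEdges C (hop v) d' v ∪ levelEdges (G.neighborSet v) (C (level C d' v)) (level C d' v) d' ∪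
    topEdges (G.neighborSet v) (C d)
      fun x => Accepts (fun w => offer (G.neighborSet w) (C d) (C d' w) x) v

/-- The graph of all selected edges. -/
def clusterSpanner (G : SimpleGraph V) (C : ℕ → V → Option V) (hop : V → V → V) (d d' : ℕ) :
    SimpleGraph V :=
  SimpleGraph.fromRel fun u v => v ∈ selected G C hop d d' u

/-- `C i v` is the center of a cluster of radius `i` around it that contains `v`, and `hop v` leads
from `v` to this center inside the cluster. -/
structure IsClustering (G : SimpleGraph V) (C : ℕ → V → Option V) (hop : V → V → V) (d' : ℕ) :
    Prop where
  zero : ∀ v, ∃ x, C 0 v = some x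
  edist_le : ∀ i ≤ d', ∀ v x, C i v = some x → G.edist v x ≤ i
  adj : ∀ i ≤ d', ∀ v x, C i v = some x → x ≠ v → G.Adj v (hop v x)
  hop_mem : ∀ i ≤ d', ∀ v x, C i v = some x → x ≠ v → C i (hop v x) = some x
  edist_hop : ∀ i ≤ d', ∀ v x, C i v = some x → x ≠ v →
    G.edist (hop v x) x + 1 = G.edist v x

/-- It suffices to bound the stretch of single edges. -/
theorem IsSpanner.of_adj {G H : SimpleGraph V} {t : ℕ} (hle : H ≤ G) (ht : 0 < t)
    (h : ∀ u v, G.Adj u v → H.edist u v ≤ t) : IsSpanner t G H := by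
  refine ⟨hle, fun u v => ?_⟩
  by_cases htop : G.edist u v = ⊤
  · rw [htop, ENat.mul_top (by exact_mod_cast ht.ne')]
    exact le_top
  · obtain ⟨p, hp⟩ := SimpleGraph.exists_walk_of_edist_ne_top htop
    rw [← hp]
    clear hp htop
    induction p with
    | nil => simp
    | cons hadj p ih =>
      refine SimpleGraph.edist_triangle.trans ((add_le_add (h _ _ hadj) ih).trans ?_)
      rw [SimpleGraph.Walk.length_cons]
      push_cast
      rw [mul_add, mul_one, add_comm]

variable {G : SimpleGraph V} {C : ℕ → V → Option V} {hop : V → V → V} {d d' : ℕ}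

theorem mem_neighborSet_of_mem_selected (h : IsClustering G C hop d') {u v : V}
    (hu : u ∈ selected G C hop d d' v) : G.Adj v u := by
  rcases hu with (⟨i, hi, x, hx, hxv, rfl⟩ | ⟨x, hx, -⟩) | ⟨x, hx, -⟩
  · exact h.adj i hi v x hx hxv
  · exact (pick_spec hx).1
  · exact (pick_spec hx).1

theorem clusterSpanner_adj (h : IsClustering G C hop d') {u v : V}
    (hu : u ∈ selected G C hop d d' v) : (clusterSpanner G C hop d d').Adj v u := by
  rw [clusterSpanner, SimpleGraph.fromRel_adj]
  exact ⟨(mem_neighborSet_of_mem_selected h hu).ne, Or.inl hu⟩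

/-- Clusters of level `i` keep radius at most `i` in the spanner. -/
theorem edist_clusterSpanner_le (h : IsClustering G C hop d') {i : ℕ} (hi : i ≤ d') {v x : V}
    (hx : C i v = some x) : (clusterSpanner G C hop d d').edist v x ≤ i := by
  have key : ∀ D : ℕ, ∀ v, C i v = some x → G.edist v x = D →
      (clusterSpanner G C hop d d').edist v x ≤ D := by
    intro D
    induction D with
    | zero =>
      intro v hx hD
      have := SimpleGraph.edist_eq_zero_iff.1 hD
      simp [this]
    | succ D ih =>
      intro v hx hD
      have hxv : x ≠ v := by
        rintro rfl
        rw [SimpleGraph.edist_self] at hD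
        exact absurd hD.symm (by norm_cast)
      have hadj : (clusterSpanner G C hop d d').Adj v (hop v x) :=
        clusterSpanner_adj h (Or.inl (Or.inl ⟨i, hi, x, hx, hxv, rfl⟩))
      have hD' := h.edist_hop i hi v x hx hxv
      rw [hD] at hD'
      push_cast at hD'
      have := ih _ (h.hop_mem i hi v x hx hxv) (by simpa using hD')
      refine SimpleGraph.edist_triangle.trans
        ((add_le_add (SimpleGraph.edist_eq_one_iff_adj.2 hadj).le this).trans ?_)
      push_cast
      rw [add_comm]
  have hle := h.edist_le i hi v x hx
  obtain ⟨D, hD⟩ := ENat.ne_top_iff_exists.1 (hle.trans_lt (ENat.natCast_lt_top _)).ne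
  rw [← hD] at hle
  exact (key D v hx hD.symm).trans hle

/-- If the endpoints of an edge first fail to be clustered at level `i + 1`, the edge is spanned
inside a cluster of level `i`; otherwise the edge chosen between two clusters of the levels `d` and
`d'` spans it. -/
theorem isSpanner_clusterSpanner (h : IsClustering G C hop d') (hd : d ≤ d') :
    IsSpanner (2 * (d + d') + 1) G (clusterSpanner G C hop d d') := by
  set H := clusterSpanner G C hop d d' with hH
  refine IsSpanner.of_adj (fun u v huv => ?_) (by omega) ?_
  · rw [hH, clusterSpanner, SimpleGraph.fromRel_adj] at huv
    rcases huv.2 with h' | h'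
    · exact mem_neighborSet_of_mem_selected h h'
    · exact (mem_neighborSet_of_mem_selected h h').symm
  have main : ∀ u v, level C d' v ≤ level C d' u → G.Adj v u →
      H.edist v u ≤ (2 * (d + d') + 1 : ℕ) := by
    intro u v hlev hadj
    rcases (level_le C d' v).lt_or_eq with hlt | heq
    · obtain ⟨x, hx⟩ := exists_of_le_level (h.zero u) hlev
      obtain ⟨w, hw⟩ := exists_pick (N := G.neighborSet v) hadj hx
      have hvw : H.Adj v w := clusterSpanner_adj h (Or.inl (Or.inr ⟨x, hw, hlt⟩))
      have h₁ : H.edist v w ≤ 1 := (SimpleGraph.edist_eq_one_iff_adj.2 hvw).le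
      have h₂ : H.edist w x ≤ level C d' v := edist_clusterSpanner_le h hlt.le (pick_spec hw).2
      have h₃ : H.edist x u ≤ level C d' v := by
        rw [SimpleGraph.edist_comm]
        exact edist_clusterSpanner_le h hlt.le hx
      refine ((H.edist_triangle (v := w)).trans (add_le_add h₁
        ((H.edist_triangle (v := x)).trans (add_le_add h₂ h₃)))).trans ?_
      norm_cast
      omega
    · obtain ⟨x, hx⟩ := exists_of_le_level (h.zero u) (hd.trans (heq.ge.trans hlev))
      obtain ⟨y, hy⟩ := exists_of_le_level (h.zero v) heq.ge
      obtain ⟨w, hw⟩ := exists_pick (N := G.neighborSet v) hadj hx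
      obtain ⟨v', hv'⟩ := exists_pick (N := Set.univ) (u := v) (x := y)
        (label := fun w => offer (G.neighborSet w) (C d) (C d' w) x) trivial
        (by simp [offer, hw, hy])
      obtain ⟨-, hoff⟩ := pick_spec hv'
      have hoff' := hoff
      simp only [offer] at hoff
      split_ifs at hoff with hsome
      obtain ⟨w', hw'⟩ := Option.isSome_iff_exists.1 hsome
      have hadj' : H.Adj v' w' := clusterSpanner_adj h (Or.inr ⟨x, hw', y, hoff', hv'⟩)
      have h₁ : H.edist v y ≤ d' := edist_clusterSpanner_le h le_rfl hy
      have h₂ : H.edist y v' ≤ d' := by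
        rw [SimpleGraph.edist_comm]
        exact edist_clusterSpanner_le h le_rfl hoff
      have h₃ : H.edist v' w' ≤ 1 := (SimpleGraph.edist_eq_one_iff_adj.2 hadj').le
      have h₄ : H.edist w' x ≤ d := edist_clusterSpanner_le h hd (pick_spec hw').2
      have h₅ : H.edist x u ≤ d := by
        rw [SimpleGraph.edist_comm]
        exact edist_clusterSpanner_le h hd hx
      refine ((H.edist_triangle (v := y)).trans (add_le_add h₁
        ((H.edist_triangle (v := v')).trans (add_le_add h₂
        ((H.edist_triangle (v := w')).trans (add_le_add h₃
        ((H.edist_triangle (v := x)).trans (add_le_add h₄ h₅)))))))).trans ?_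
      norm_cast
      omega
  intro u v huv
  rcases le_total (level C d' v) (level C d' u) with hl | hl
  · rw [SimpleGraph.edist_comm]
    exact main u v hl huv.symm
  · exact main v u hl huv

theorem ncard_treeEdges_le [Finite V] (f : V → V) (v : V) :
    (treeEdges C f d' v).ncard ≤ d' + 1 := by
  refine (Set.ncard_le_ncard (t := (fun i => f ((C i v).getD v)) '' ↑(Finset.range (d' + 1))) ?_
    (Set.toFinite _)).trans ((Set.ncard_image_le (Set.toFinite _)).trans ?_)
  · rintro u ⟨i, hi, x, hx, -, rfl⟩
    refine ⟨i, ?_, by simp [hx]⟩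
    simpa using Nat.lt_succ_of_le hi
  · rw [Set.ncard_coe_finset, Finset.card_range]

/-- Every pair of a center of level `d` and a center of level `d'` pays for at most one edge. -/
theorem sum_ncard_topEdges_le [Fintype V] {A A' : Set V} (hA : ∀ v x, C d v = some x → x ∈ A)
    (hA' : ∀ v x, C d' v = some x → x ∈ A') :
    ∑ v, (topEdges (G.neighborSet v) (C d)
      fun x => Accepts (fun w => offer (G.neighborSet w) (C d) (C d' w) x) v).ncard ≤
      A.ncard * A'.ncard := by
  classical
  let acc : V → V → Prop := fun v x =>
    Accepts (fun w => offer (G.neighborSet w) (C d) (C d' w) x) v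
  have h₁ : ∀ v, (topEdges (G.neighborSet v) (C d) (acc v)).ncard ≤
      ∑ x ∈ A.toFinset, if acc v x then 1 else 0 := by
    intro v
    refine (ncard_pick_le _ _ _).trans ?_
    rw [← Finset.card_filter, ← Set.ncard_coe_finset]
    refine Set.ncard_le_ncard ?_ (Set.toFinite _)
    rintro x ⟨⟨u, -, hu⟩, hx⟩
    simpa using ⟨hA u x hu, hx⟩
  refine (Finset.sum_le_sum fun v _ => h₁ v).trans ?_
  rw [Finset.sum_comm, Set.ncard_eq_toFinset_card' A, ← smul_eq_mul, ← Finset.sum_const]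
  refine Finset.sum_le_sum fun x _ => ?_
  rw [← Finset.card_filter, Set.ncard_eq_toFinset_card' A']
  refine Finset.card_le_card_of_injOn
    (fun v => (offer (G.neighborSet v) (C d) (C d' v) x).getD v) ?_ ?_
  · intro v hv
    obtain ⟨y, hy, -⟩ := (Finset.mem_filter.1 hv).2
    simp only [hy, Option.getD_some, Set.coe_toFinset]
    simp only [offer] at hy
    split_ifs at hy
    exact hA' v y hy
  · intro v hv w hw hvw
    obtain ⟨y, hy, hpy⟩ := (Finset.mem_filter.1 hv).2
    obtain ⟨z, hz, hpz⟩ := (Finset.mem_filter.1 hw).2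
    simp only [hy, hz, Option.getD_some] at hvw
    subst hvw
    exact Option.some.inj (hpy.symm.trans hpz)

theorem ncard_edgeSet_clusterSpanner_le [Fintype V] {A A' : Set V} {t : ℕ}
    (hA : ∀ v x, C d v = some x → x ∈ A) (hA' : ∀ v x, C d' v = some x → x ∈ A')
    (ht : ∀ v, ∀ i < d', C (i + 1) v = none →
      {x | ∃ u ∈ G.neighborSet v, C i u = some x}.ncard ≤ t) :
    (clusterSpanner G C hop d d').edgeSet.ncard ≤
      Fintype.card V * (d' + 1) + Fintype.card V * t + A.ncard * A'.ncard := by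
  classical
  have hsub : (clusterSpanner G C hop d d').edgeSet ⊆
      ↑(Finset.univ.biUnion fun v => (selected G C hop d d' v).toFinset.image fun u => s(v, u)) := by
    intro e
    induction e with
    | _ u v =>
      intro he
      rw [SimpleGraph.mem_edgeSet, clusterSpanner, SimpleGraph.fromRel_adj] at he
      simp only [Finset.coe_biUnion, Finset.coe_image, Set.coe_toFinset, Set.mem_iUnion]
      rcases he.2 with h | h
      · exact ⟨u, by simp, v, h, rfl⟩
      · exact ⟨v, by simp, u, h, Sym2.eq_swap⟩
  refine (Set.ncard_le_ncard hsub (Set.toFinite _)).trans ?_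
  rw [Set.ncard_coe_finset]
  refine Finset.card_biUnion_le.trans ?_
  have hsel : ∀ v, ((selected G C hop d d' v).toFinset.image fun u => s(v, u)).card ≤
      (d' + 1) + t + (topEdges (G.neighborSet v) (C d)
      fun x => Accepts (fun w => offer (G.neighborSet w) (C d) (C d' w) x) v).ncard := by
    intro v
    refine Finset.card_image_le.trans ?_
    rw [← Set.ncard_eq_toFinset_card']
    refine (Set.ncard_union_le _ _).trans (Nat.add_le_add_right ?_ _)
    refine (Set.ncard_union_le _ _).trans (Nat.add_le_add (ncard_treeEdges_le _ _) ?_)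
    refine (ncard_pick_le _ _ _).trans ?_
    by_cases hl : level C d' v < d'
    · simpa [hl] using ht v _ hl (eq_none_of_level_lt hl)
    · simp [hl]
  refine (Finset.sum_le_sum fun v _ => hsel v).trans ?_
  rw [Finset.sum_add_distrib, Finset.sum_const, Finset.card_univ, smul_eq_mul, mul_add]
  exact Nat.add_le_add_left (sum_ncard_topEdges_le hA hA') _

end ClusterSpanner

/-! ### Communication of the clusters -/

namespace CongestedClique

variable {n m b T : ℕ}

/-- Once every node knows its clusters, the next hops towards their centers and its neighbours, five
rounds suffice to construct the cluster spanner: levels are announced, neighbours answer with the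
centers asked for, offers are made, accepted, and the selected edges are announced. -/
theorem knows_clusterSpanner {C : SimpleGraph (Fin n) → (Fin n → Fin m → Bool) → ℕ → Fin n →
      Option (Fin n)} {hop : SimpleGraph (Fin n) → (Fin n → Fin m → Bool) → Fin n → Fin n → Fin n}
    (hK : Knows b T (fun G ω v => ((fun i => C G ω i v), hop G ω v, G.neighborSet v)))
    {d d' : ℕ} (hd : d' < n) (hn : 2 ≤ n) (hb : (n + 1) * (n + 1) ≤ 2 ^ b) :
    Knows b (T + 5)
      (fun G ω v => (clusterSpanner G (C G ω) (hop G ω) d d').neighborSet v) := by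
  classical
  have hb₁ : n + 1 ≤ 2 ^ b := le_trans (by nlinarith) hb
  have : NeZero (d' + 1) := ⟨by omega⟩
  have K₁ := (hK.map fun v x => (x, level (fun i _ => x.1 i) d' v)).exchange
    (μ := Fin (d' + 1)) (by simpa using by omega) fun _ x _ => Fin.ofNat (d' + 1) x.2
  have K₂ := K₁.exchange (μ := Option (Fin n) × Option (Fin n)) (by simpa using hb)
    fun u x v => (x.1.1.1 (x.2 v), x.1.1.1 d)
  have K₃ := K₂.exchange (μ := Option (Fin n)) (by simpa using hb₁)
    fun v x c => offer x.1.1.1.2.2 (fun u => (x.2 u).2) (x.1.1.1.1 d') c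
  have K₄ := K₃.exchange (μ := Bool) (by simpa using by omega)
    fun _ x v => decide (Accepts x.2 v)
  have K₅ := (K₄.map fun v x =>
      treeEdges (fun i _ => x.1.1.1.1.1.1 i) x.1.1.1.1.1.2.1 d' v ∪
      levelEdges x.1.1.1.1.1.2.2 (fun u => (x.1.1.2 u).1) x.1.1.1.1.2 d' ∪
      topEdges x.1.1.1.1.1.2.2 (fun u => (x.1.1.2 u).2) fun c => x.2 c = true).exchange
    (μ := Bool) (by simpa using by omega) fun _ x v => decide (v ∈ x)
  refine (K₅.map fun v x => {u | v ≠ u ∧ (u ∈ x.1 ∨ x.2 u = true)}).congr fun G ω v => ?_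
  have hlev : ∀ u, ((Fin.ofNat (d' + 1) (level (fun i _ => C G ω i u) d' u) : Fin (d' + 1)) : ℕ) =
      level (C G ω) d' u := fun u =>
    Nat.mod_eq_of_lt (Nat.lt_succ_of_le (level_le (C G ω) d' u))
  ext u
  simp only [hlev, decide_eq_true_eq]
  rw [SimpleGraph.mem_neighborSet, clusterSpanner, SimpleGraph.fromRel_adj]
  rfl

end CongestedClique

/-! ### Random samples of vertices -/

section Sampling

/-- The probability of an event in a finite uniform probability space. -/
noncomputable def freq {α : Type*} [Fintype α] (E : Set α) : ℝ :=
  (E.ncard : ℝ) / (Fintype.card α : ℝ)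

section freq

variable {α : Type*} [Fintype α]

theorem freq_mono {E F : Set α} (h : E ⊆ F) : freq E ≤ freq F := by
  unfold freq
  gcongr
  exact Set.toFinite _

theorem freq_union_le (E F : Set α) : freq (E ∪ F) ≤ freq E + freq F := by
  unfold freq
  rw [← add_div]
  gcongr
  exact_mod_cast Set.ncard_union_le E F

theorem freq_iUnion_le {ι : Type*} [Fintype ι] (E : ι → Set α) {p : ℝ} (h : ∀ i, freq (E i) ≤ p) :
    freq (⋃ i, E i) ≤ Fintype.card ι * p := by
  have key : freq (⋃ i, E i) ≤ ∑ i, freq (E i) := by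
    unfold freq
    rw [← Finset.sum_div]
    gcongr
    have := Set.ncard_iUnion_le_of_fintype E
    exact_mod_cast this
  refine key.trans ((Finset.sum_le_sum fun i _ => h i).trans ?_)
  simp

theorem one_sub_le_freq [Nonempty α] {E : Set α} {p : ℝ} (h : freq Eᶜ ≤ p) : 1 - p ≤ freq E := by
  have : freq E + freq Eᶜ = 1 := by
    unfold freq
    rw [← add_div, div_eq_one_iff_eq (by exact_mod_cast Fintype.card_ne_zero)]
    rw [← Nat.card_eq_fintype_card]
    exact_mod_cast Set.ncard_add_ncard_compl E
  linarith

end freq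

variable {V Ω : Type*} [Fintype V] [Fintype Ω]

/-- Markov's inequality for a product of independent identically distributed factors. -/
theorem freq_le_of_prod [DecidableEq V] [Nonempty Ω] {g : Ω → ℝ} (hg : ∀ r, 0 ≤ g r) {γ : ℝ}
    (hγ : ∑ r, g r ≤ γ * Fintype.card Ω) (B : Finset V) {X : ℝ} (hX : 0 < X)
    {E : Set (V → Ω)} (hE : ∀ ω ∈ E, X ≤ ∏ v ∈ B, g (ω v)) : freq E ≤ γ ^ B.card / X := by
  classical
  have hN : (0 : ℝ) < Fintype.card Ω := by exact_mod_cast Fintype.card_pos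
  have hprod : ∑ ω : V → Ω, ∏ v ∈ B, g (ω v) ≤ γ ^ B.card * Fintype.card (V → Ω) := by
    have h₁ : ∀ ω : V → Ω, ∏ v ∈ B, g (ω v) = ∏ v, if v ∈ B then g (ω v) else 1 := fun ω => by
      rw [Finset.prod_ite_mem, Finset.univ_inter]
    have h₂ : ∑ ω : V → Ω, ∏ v, (if v ∈ B then g (ω v) else 1) =
        ∏ v, ∑ r, if v ∈ B then g r else 1 := by
      rw [Finset.prod_univ_sum, Fintype.piFinset_univ]
    simp_rw [h₁]
    rw [h₂]
    have h₃ : ∀ v : V, ∑ r, (if v ∈ B then g r else 1) ≤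
        (if v ∈ B then γ else 1) * Fintype.card Ω := fun v => by
      split_ifs
      · exact hγ
      · simp
    refine (Finset.prod_le_prod (fun v _ => Finset.sum_nonneg fun r _ => ?_)
      fun v _ => h₃ v).trans ?_
    · split_ifs
      · exact hg r
      · exact zero_le_one
    · rw [Finset.prod_mul_distrib, Finset.prod_ite_mem, Finset.univ_inter, Finset.prod_const,
        Finset.prod_const, Finset.card_univ, Fintype.card_fun]
      push_cast
      exact le_rfl
  have hcard : (E.ncard : ℝ) * X ≤ ∑ ω : V → Ω, ∏ v ∈ B, g (ω v) := by
    rw [Set.ncard_eq_toFinset_card', ← nsmul_eq_mul, ← Finset.sum_const]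
    refine (Finset.sum_le_sum fun ω hω => hE ω (by simpa using hω)).trans ?_
    exact Finset.sum_le_sum_of_subset_of_nonneg (Finset.subset_univ _)
      fun ω _ _ => Finset.prod_nonneg fun v _ => hg _
  unfold freq
  rw [div_le_div_iff₀ (by exact_mod_cast Fintype.card_pos) hX]
  exact hcard.trans hprod

variable [Nonempty Ω] [DecidableEq V]

/-- A random sample of density `q` misses a fixed set of size `b` with probability at most
`exp (- q * b)`. -/
theorem freq_miss_le {S : Set Ω} {q : ℝ} (hq : q * Fintype.card Ω ≤ S.ncard) (B : Finset V) :
    freq {ω : V → Ω | ∀ v ∈ B, ω v ∉ S} ≤ Real.exp (-(q * B.card)) := by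
  classical
  have hsum : ∑ r, (if r ∈ S then (0 : ℝ) else 1) ≤ Real.exp (-q) * Fintype.card Ω := by
    have h : ∑ r, (if r ∈ S then (0 : ℝ) else 1) = Fintype.card Ω - S.ncard := by
      have h' : ∀ r, (if r ∈ S then (0 : ℝ) else 1) = 1 - if r ∈ S then 1 else 0 := fun r => by
        split_ifs <;> simp
      simp_rw [h']
      rw [Finset.sum_sub_distrib, Finset.sum_boole, Set.ncard_eq_toFinset_card']
      simp [Set.toFinset]
    rw [h]
    have := Real.add_one_le_exp (-q)
    nlinarith [(Nat.cast_nonneg (Fintype.card Ω) : (0 : ℝ) ≤ _)]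
  refine (freq_le_of_prod (fun r => by split_ifs <;> simp) hsum B one_pos ?_).trans ?_
  · intro ω hω
    rw [Finset.prod_eq_one fun v hv => if_neg (hω v hv)]
  · rw [div_one, ← Real.exp_nat_mul]
    apply le_of_eq
    ring_nf

/-- If `S' ⊆ S` has relative density at least `ρ`, a fixed set that contains at least `t` samples
from `S` contains no sample from `S'` with probability at most `exp (- ρ * t)`. -/
theorem freq_many_miss_le {S S' : Set Ω} (hS : S' ⊆ S) {ρ : ℝ} (hρ : ρ < 1)
    (hSρ : ρ * S.ncard ≤ S'.ncard) (hρ0 : 0 ≤ ρ) (B : Finset V) (t : ℕ) :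
    freq {ω : V → Ω | (∀ v ∈ B, ω v ∉ S') ∧ t ≤ {v | v ∈ B ∧ ω v ∈ S}.ncard} ≤
      Real.exp (-(ρ * t)) := by
  classical
  have h1 : 0 < 1 - ρ := by linarith
  let g : Ω → ℝ := fun r => if r ∈ S' then 0 else if r ∈ S then (1 - ρ)⁻¹ else 1
  have hinv : 1 ≤ (1 - ρ)⁻¹ := (one_le_inv₀ h1).2 (by linarith)
  have hsum : ∑ r, g r ≤ 1 * Fintype.card Ω := by
    have h' : ∀ r, g r = 1 + ((1 - ρ)⁻¹ - 1) * (if r ∈ S then 1 else 0) -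
        (1 - ρ)⁻¹ * (if r ∈ S' then 1 else 0) := fun r => by
      by_cases h₁ : r ∈ S'
      · simp [g, h₁, hS h₁]
      · by_cases h₂ : r ∈ S <;> simp [g, h₁, h₂]
    simp_rw [h']
    rw [Finset.sum_sub_distrib, Finset.sum_add_distrib, ← Finset.mul_sum, ← Finset.mul_sum,
      Finset.sum_boole, Finset.sum_boole]
    have e : ∀ S : Set Ω, ((Finset.univ.filter fun r => r ∈ S).card : ℝ) = S.ncard := fun S => by
      rw [Set.ncard_eq_toFinset_card']
      simp [Set.toFinset]
    rw [e, e]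
    have h₂ : ((1 - ρ)⁻¹ - 1) * (S.ncard : ℝ) = (1 - ρ)⁻¹ * (ρ * S.ncard) := by
      field_simp
      ring
    rw [h₂]
    have := mul_le_mul_of_nonneg_left hSρ (zero_le_one.trans hinv)
    simp only [Finset.sum_const, Finset.card_univ, nsmul_eq_mul, mul_one]
    linarith
  have hg : ∀ r, 0 ≤ g r := fun r => by
    simp only [g]
    split_ifs
    · exact le_rfl
    · exact zero_le_one.trans hinv
    · exact zero_le_one
  refine (freq_le_of_prod hg hsum B (X := (1 - ρ)⁻¹ ^ t) (by positivity) ?_).trans ?_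
  · rintro ω ⟨hω, ht⟩
    have hg' : ∀ v ∈ B, g (ω v) = if ω v ∈ S then (1 - ρ)⁻¹ else 1 := fun v hv => by
      simp [g, hω v hv]
    rw [Finset.prod_congr rfl hg', Finset.prod_ite, Finset.prod_const, Finset.prod_const_one,
      mul_one]
    refine pow_le_pow_right₀ hinv ?_
    rw [← Set.ncard_coe_finset]
    simpa using ht
  · rw [one_pow, one_div, inv_pow, inv_inv]
    calc (1 - ρ) ^ t ≤ Real.exp (-ρ) ^ t := by
          refine pow_le_pow_left₀ h1.le ?_ t
          have := Real.add_one_le_exp (-ρ)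
          linarith
      _ = Real.exp (-(ρ * t)) := by
          rw [← Real.exp_nat_mul]
          ring_nf

/-- A random sample of density `q` has at least `t` elements with probability at most
`exp (q * |V|) / 2 ^ t`. -/
theorem freq_many_le {S : Set Ω} {q : ℝ} (hq : S.ncard ≤ q * Fintype.card Ω) (t : ℕ) :
    freq {ω : V → Ω | t ≤ {v | ω v ∈ S}.ncard} ≤ Real.exp (q * Fintype.card V) / 2 ^ t := by
  classical
  have hsum : ∑ r, (if r ∈ S then (2 : ℝ) else 1) ≤ Real.exp q * Fintype.card Ω := by
    have h : ∑ r, (if r ∈ S then (2 : ℝ) else 1) = Fintype.card Ω + S.ncard := by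
      have h' : ∀ r, (if r ∈ S then (2 : ℝ) else 1) = 1 + if r ∈ S then 1 else 0 := fun r => by
        split_ifs <;> norm_num
      simp_rw [h']
      rw [Finset.sum_add_distrib, Finset.sum_boole, Set.ncard_eq_toFinset_card']
      simp [Set.toFinset]
    rw [h]
    have := Real.add_one_le_exp q
    nlinarith [(Nat.cast_nonneg (Fintype.card Ω) : (0 : ℝ) ≤ _)]
  refine (freq_le_of_prod (fun r => by split_ifs <;> simp) hsum Finset.univ (X := 2 ^ t)
    (by positivity) ?_).trans ?_
  · intro ω hω
    rw [Finset.prod_ite, Finset.prod_const, Finset.prod_const_one, mul_one]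
    refine pow_le_pow_right₀ one_le_two ?_
    rw [← Set.ncard_coe_finset]
    simpa using hω
  · rw [← Real.exp_nat_mul, Finset.card_univ, mul_comm]

end Sampling

/-! ### The samples of centers -/

section Samples

/-- The density `n ^ (- i / k)` of the centers of level `i`, up to logarithmic factors. -/
noncomputable def density (n k i : ℕ) : ℝ := (n : ℝ) ^ (-(i : ℝ) / k)

/-- The factor by which centers are oversampled. The constant `c + 6` makes every bad event have
probability at most `n ^ (- (c + 6))`, which leaves room for `n ^ 6` of them. -/
noncomputable def oversampling (n c : ℕ) : ℝ := 2 * (c + 6) * Real.log n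

/-- The maximal number of edges that a vertex adds to clusters of its level. -/
noncomputable def maxDegree (n k c : ℕ) : ℕ :=
  ⌈2 * (n : ℝ) ^ (1 / (k : ℝ)) * (c + 6) * Real.log n⌉₊

theorem one_le_log {n : ℕ} (hn : 3 ≤ n) : 1 ≤ Real.log n := by
  rw [Real.le_log_iff_exp_le (by positivity)]
  have : (3 : ℝ) ≤ n := by exact_mod_cast hn
  exact (Real.exp_one_lt_d9.le.trans (by norm_num)).trans this

variable {n k c : ℕ}

theorem density_pos (hn : 3 ≤ n) (i : ℕ) : 0 < density n k i := by
  unfold density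
  positivity

theorem density_mul_eq (hn : 3 ≤ n) (i j : ℕ) :
    density n k i * density n k j = density n k (i + j) := by
  unfold density
  rw [← Real.rpow_add (by positivity)]
  push_cast
  ring_nf

theorem density_anti (hn : 3 ≤ n) {i j : ℕ} (hij : i ≤ j) : density n k j ≤ density n k i := by
  unfold density
  have : (1 : ℝ) ≤ n := by exact_mod_cast (by omega : 1 ≤ n)
  refine Real.rpow_le_rpow_of_exponent_le this ?_
  have : (i : ℝ) ≤ j := by exact_mod_cast hij
  gcongr

theorem one_le_mul_density (hn : 3 ≤ n) (hk : 0 < k) {i : ℕ} (hi : i ≤ k) :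
    1 ≤ n * density n k i := by
  have h : density n k k = (n : ℝ)⁻¹ := by
    unfold density
    rw [neg_div, div_self (by positivity), Real.rpow_neg_one]
  have h' := density_anti (k := k) hn hi
  rw [h] at h'
  have hn' : (0 : ℝ) < n := by positivity
  calc (1 : ℝ) = n * (n : ℝ)⁻¹ := by field_simp
    _ ≤ _ := by gcongr

/-- The vertices nearest to `v` that a node keeps are enough to be hit by a sample of any level up
to `k / 2`. -/
theorem half_le_sqrt_mul_density (hn : 3 ≤ n) (hk : 0 < k) {i : ℕ} (hi : i ≤ k / 2) :
    1 / 2 ≤ Nat.sqrt n * density n k i := by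
  have hn' : (0 : ℝ) < n := by positivity
  have hi' : (i : ℝ) / k ≤ 1 / 2 := by
    rw [div_le_div_iff₀ (by positivity) (by norm_num)]
    exact_mod_cast (by omega : i * 2 ≤ 1 * k)
  have h₁ : (n : ℝ) ^ (-(1 / 2) : ℝ) ≤ density n k i := by
    unfold density
    refine Real.rpow_le_rpow_of_exponent_le (by exact_mod_cast (by omega : 1 ≤ n)) ?_
    rw [neg_div]
    linarith
  rw [Real.rpow_neg hn'.le, ← Real.sqrt_eq_rpow] at h₁
  have h₂ : √(n : ℝ) ≤ 2 * Nat.sqrt n := by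
    rw [Real.sqrt_le_left (by positivity)]
    have h₃ := Nat.lt_succ_sqrt n
    have h₄ : 1 ≤ Nat.sqrt n := Nat.le_sqrt.2 (by omega)
    have : n ≤ (2 * Nat.sqrt n) ^ 2 := by
      simp only [Nat.succ_eq_add_one] at h₃
      nlinarith
    exact_mod_cast this
  have hs : 0 < √(n : ℝ) := Real.sqrt_pos.2 hn'
  calc (1 : ℝ) / 2 = (√(n : ℝ) / 2) * (√(n : ℝ))⁻¹ := by field_simp
    _ ≤ Nat.sqrt n * density n k i := by
      gcongr
      linarith

theorem oversampling_ge (hn : 3 ≤ n) : 1 ≤ oversampling n c := by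
  unfold oversampling
  have := one_le_log hn
  have hc : (0 : ℝ) ≤ c := by positivity
  nlinarith

/-- A decreasing sequence of sets of bit strings whose densities are, up to constant factors,
`oversampling n c * n ^ (- i / k)`. -/
theorem exists_samples (hn : 3 ≤ n) (hk : 0 < k) :
    ∃ S : ℕ → Set (Fin (Nat.clog 2 n) → Bool), S 0 = Set.univ ∧ (∀ i, S (i + 1) ⊆ S i) ∧
      (∀ i, S i = Set.univ ∨ oversampling n c * density n k i *
        Fintype.card (Fin (Nat.clog 2 n) → Bool) ≤ (S i).ncard) ∧
      (∀ i ≤ k, ((S i).ncard : ℝ) ≤ 2 * oversampling n c * density n k i *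
        Fintype.card (Fin (Nat.clog 2 n) → Bool)) ∧
      (∀ i < k, density n k 1 / 2 * (S i).ncard ≤ (S (i + 1)).ncard) := by
  classical
  set N := Fintype.card (Fin (Nat.clog 2 n) → Bool) with hN
  have hnN : n ≤ N := by
    rw [hN]
    simpa using Nat.le_pow_clog one_lt_two n
  have hnN' : (n : ℝ) ≤ N := by exact_mod_cast hnN
  let e : (Fin (Nat.clog 2 n) → Bool) ≃ Fin N := Fintype.equivFin _
  let x : ℕ → ℝ := fun i => oversampling n c * density n k i * N
  let S : ℕ → Set (Fin (Nat.clog 2 n) → Bool) := fun i => {r | (e r : ℕ) < ⌈x i⌉₊}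
  have hL := oversampling_ge (c := c) hn
  have hcard : ∀ i, (S i).ncard = min ⌈x i⌉₊ N := fun i => by
    have h₁ : (S i).ncard = {j : Fin N | (j : ℕ) < ⌈x i⌉₊}.ncard := by
      rw [← Set.ncard_image_of_injective _ e.injective]
      congr 1
      ext j
      constructor
      · rintro ⟨r, hr, rfl⟩
        exact hr
      · intro hj
        exact ⟨e.symm j, by simpa [S] using hj, by simp⟩
    rw [h₁, Set.ncard_eq_toFinset_card', Set.toFinset_ofPred]
    rw [Fin.card_filter_val_lt, min_comm]
  have hx0 : ∀ i, 0 ≤ x i := fun i => by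
    have := density_pos (k := k) hn i
    positivity
  have hx1 : ∀ i ≤ k, 1 ≤ x i := fun i hi => by
    have h₁ := one_le_mul_density hn hk hi
    have h₂ : (n : ℝ) * density n k i ≤ N * density n k i := by
      have := (density_pos (k := k) hn i).le
      gcongr
    simp only [x]
    nlinarith
  refine ⟨S, ?_, fun i r hr => ?_, fun i => ?_, fun i hi => ?_, fun i hi => ?_⟩
  · refine Set.eq_univ_of_forall fun r => (e r).2.trans_le ?_
    have h : (N : ℝ) ≤ x 0 := by
      simp only [x, density]
      simp only [Nat.cast_zero, neg_zero, zero_div, Real.rpow_zero, mul_one]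
      nlinarith [(Nat.cast_nonneg N : (0 : ℝ) ≤ N)]
    exact_mod_cast h.trans (Nat.le_ceil _)
  · refine lt_of_lt_of_le (show (e r : ℕ) < ⌈x (i + 1)⌉₊ from hr) (Nat.ceil_le_ceil ?_)
    have := density_anti (k := k) hn (Nat.le_succ i)
    simp only [x]
    gcongr
  · by_cases h : N ≤ ⌈x i⌉₊
    · exact Or.inl (Set.eq_univ_of_forall fun r => (e r).2.trans_le h)
    · right
      rw [hcard, min_eq_left (by omega)]
      exact Nat.le_ceil _
  · rw [hcard]
    have h₁ : ((min ⌈x i⌉₊ N : ℕ) : ℝ) ≤ ⌈x i⌉₊ := by exact_mod_cast min_le_left _ _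
    have h₂ := Nat.ceil_lt_add_one (hx0 i)
    have h₃ := hx1 i hi
    have h₄ : 2 * oversampling n c * density n k i * N = 2 * x i := by
      simp only [x]
      ring
    rw [h₄]
    linarith
  · rw [hcard, hcard]
    have hd := density_pos (k := k) hn 1
    have hd1 : density n k 1 ≤ 1 := by
      have := density_anti (k := k) hn (Nat.zero_le 1)
      simpa [density] using this
    have hx : x (i + 1) = density n k 1 * x i := by
      simp only [x, ← density_mul_eq hn i 1]
      ring
    push_cast
    rw [le_min_iff]
    constructor
    -- Rounding up costs at most a factor of two because `x i ≥ 1`.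
    · have h₂ := Nat.ceil_lt_add_one (hx0 i)
      have h₃ := hx1 i hi.le
      have h₄ := Nat.le_ceil (x (i + 1))
      have h₅ : min (⌈x i⌉₊ : ℝ) N ≤ 2 * x i := (min_le_left _ _).trans (by linarith)
      calc density n k 1 / 2 * min (⌈x i⌉₊ : ℝ) N ≤ density n k 1 / 2 * (2 * x i) := by gcongr
        _ = x (i + 1) := by rw [hx]; ring
        _ ≤ _ := h₄
    · have h₅ : min (⌈x i⌉₊ : ℝ) N ≤ N := min_le_right _ _
      have h₀ : 0 ≤ min (⌈x i⌉₊ : ℝ) N := by positivity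
      nlinarith

/-- The sampled centers are as good as expected: they hit every long initial segment of the vertices
sorted by distance, only few of them lie in a ball without a center of the next level, and their
number is close to its expectation. -/
structure IsGoodSample (G : SimpleGraph (Fin n)) (k c : ℕ)
    (S : ℕ → Set (Fin (Nat.clog 2 n) → Bool)) (ω : Fin n → Fin (Nat.clog 2 n) → Bool) : Prop where
  hit : ∀ v w, ∀ i ≤ k / 2, Nat.sqrt n ≤ (before (G.edist v) w).card →
    ∃ y ∈ before (G.edist v) w, ω y ∈ S i
  few : ∀ v, ∀ i < k / 2, (∀ x, G.edist v x ≤ (i + 1 : ℕ) → ω x ∉ S (i + 1)) →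
    {x | G.edist v x ≤ (i + 1 : ℕ) ∧ ω x ∈ S i}.ncard ≤ maxDegree n k c
  card : ∀ i ≤ k / 2, ({v | ω v ∈ S i}.ncard : ℝ) ≤ 8 * oversampling n c * density n k i * n

theorem exp_neg_log (hn : 3 ≤ n) {x : ℝ} (hx : (c + 6) * Real.log n ≤ x) :
    Real.exp (-x) ≤ 1 / (n : ℝ) ^ (c + 6) := by
  have hn' : (0 : ℝ) < n := by positivity
  calc Real.exp (-x) ≤ Real.exp (-((c + 6 : ℕ) * Real.log n)) := by
        gcongr
        push_cast
        exact hx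
    _ = _ := by
      rw [Real.exp_neg, Real.exp_nat_mul, Real.exp_log hn', one_div]

theorem freq_isGoodSample (G : SimpleGraph (Fin n)) (hk : 2 ≤ k) (hkn : k < n)
    {S : ℕ → Set (Fin (Nat.clog 2 n) → Bool)} (hsub : ∀ i, S (i + 1) ⊆ S i)
    (hlow : ∀ i, S i = Set.univ ∨ oversampling n c * density n k i *
        Fintype.card (Fin (Nat.clog 2 n) → Bool) ≤ (S i).ncard)
    (hup : ∀ i ≤ k, ((S i).ncard : ℝ) ≤ 2 * oversampling n c * density n k i *
        Fintype.card (Fin (Nat.clog 2 n) → Bool))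
    (hratio : ∀ i < k, density n k 1 / 2 * (S i).ncard ≤ (S (i + 1)).ncard) :
    1 - 1 / (n : ℝ) ^ c ≤ freq {ω | IsGoodSample G k c S ω} := by
  classical
  have hn : 3 ≤ n := by omega
  have hn' : (0 : ℝ) < n := by positivity
  have hlog := one_le_log hn
  have hL := oversampling_ge (c := c) hn
  have hLdef : oversampling n c = 2 * (c + 6) * Real.log n := rfl
  have hc0 : (0 : ℝ) ≤ c := by positivity
  set p : ℝ := 1 / (n : ℝ) ^ (c + 6) with hp
  have hp0 : 0 ≤ p := by positivity
  -- The bad events are: a long initial segment is missed (`E₁`), there are many centers in a ball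
  -- without a center of the next level (`E₂`), and there are too many centers (`E₃`).
  let E₁ : Fin n × Fin n × Fin (k / 2 + 1) → Set (Fin n → Fin (Nat.clog 2 n) → Bool) :=
    fun z => {ω | Nat.sqrt n ≤ (before (G.edist z.1) z.2.1).card ∧
      ∀ y ∈ before (G.edist z.1) z.2.1, ω y ∉ S z.2.2}
  let ball : Fin n → ℕ → Finset (Fin n) := fun v i => Finset.univ.filter fun x => G.edist v x ≤ i
  let E₂ : Fin n × Fin (k / 2) → Set (Fin n → Fin (Nat.clog 2 n) → Bool) :=
    fun z => {ω | (∀ x ∈ ball z.1 (z.2 + 1), ω x ∉ S (z.2 + 1)) ∧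
      maxDegree n k c ≤ {x | x ∈ ball z.1 (z.2 + 1) ∧ ω x ∈ S z.2}.ncard}
  let T : ℕ → ℕ := fun i => ⌈3 * (2 * oversampling n c * density n k i * n)⌉₊
  let E₃ : Fin (k / 2 + 1) → Set (Fin n → Fin (Nat.clog 2 n) → Bool) :=
    fun i => {ω | T i ≤ {v | ω v ∈ S i}.ncard}
  have h₁ : ∀ z, freq (E₁ z) ≤ p := by
    rintro ⟨v, w, i, hi⟩
    have hsqrt : 1 ≤ Nat.sqrt n := Nat.le_sqrt.2 (by omega)
    by_cases hs : Nat.sqrt n ≤ (before (G.edist v) w).card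
    · rcases hlow i with h | h
      -- If every vertex is a center, the bound `exp (- q * b)` with `q ≤ 1` would not be enough.
      · have : E₁ (v, w, ⟨i, hi⟩) = ∅ := by
          obtain ⟨y, hy⟩ := Finset.card_pos.1 (by omega : 0 < (before (G.edist v) w).card)
          refine Set.eq_empty_of_forall_notMem fun ω hω => hω.2 y hy ?_
          simp [h]
        rw [this]
        simpa [freq] using hp0
      · refine (freq_mono fun ω hω => hω.2).trans ((freq_miss_le h _).trans ?_)
        refine exp_neg_log hn ?_
        have h₂ := half_le_sqrt_mul_density hn (by omega) (Nat.lt_succ_iff.1 hi)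
        have h₃ : (Nat.sqrt n : ℝ) ≤ (before (G.edist v) w).card := by exact_mod_cast hs
        have h₄ := (density_pos (k := k) hn i).le
        calc (c + 6) * Real.log n = oversampling n c * (1 / 2) := by rw [hLdef]; ring
          _ ≤ oversampling n c * (Nat.sqrt n * density n k i) := by gcongr
          _ ≤ oversampling n c * ((before (G.edist v) w).card * density n k i) := by gcongr
          _ = _ := by ring
    · have : E₁ (v, w, ⟨i, hi⟩) = ∅ := Set.eq_empty_of_forall_notMem fun ω hω => hs hω.1
      rw [this]
      simpa [freq] using hp0
  have h₂ : ∀ z, freq (E₂ z) ≤ p := by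
    rintro ⟨v, i, hi⟩
    have hd := density_pos (k := k) hn 1
    have hd1 : density n k 1 ≤ 1 := by
      have := density_anti (k := k) hn (Nat.zero_le 1)
      simpa [density] using this
    refine (freq_many_miss_le (hsub i) (by linarith) (hratio i (by omega)) (by positivity)
      _ _).trans (exp_neg_log hn ?_)
    have hcancel : density n k 1 * (n : ℝ) ^ (1 / (k : ℝ)) = 1 := by
      unfold density
      rw [← Real.rpow_add hn']
      simp [neg_div]
    calc (c + 6) * Real.log n
        = (density n k 1 * (n : ℝ) ^ (1 / (k : ℝ))) * ((c + 6) * Real.log n) := by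
          rw [hcancel, one_mul]
      _ = density n k 1 / 2 * (2 * (n : ℝ) ^ (1 / (k : ℝ)) * (c + 6) * Real.log n) := by ring
      _ ≤ density n k 1 / 2 * maxDegree n k c := by
        gcongr
        exact Nat.le_ceil _
  have h₃ : ∀ i, freq (E₃ i) ≤ p := by
    rintro ⟨i, hi⟩
    refine (freq_many_le (hup i (by omega)) _).trans ?_
    set Q : ℝ := 2 * oversampling n c * density n k i * n with hQ
    have hQT : 3 * Q ≤ T i := Nat.le_ceil _
    have hQL : 2 * oversampling n c ≤ Q := by
      have := one_le_mul_density hn (by omega) (by omega : i ≤ k)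
      calc 2 * oversampling n c = 2 * oversampling n c * 1 := by ring
        _ ≤ 2 * oversampling n c * (n * density n k i) := by gcongr
        _ = Q := by rw [hQ]; ring
    have h2 : Real.exp (2 * Q) ≤ 2 ^ T i := by
      have : (2 : ℝ) ^ T i = Real.exp (T i * Real.log 2) := by
        rw [Real.exp_nat_mul, Real.exp_log two_pos]
      rw [this, Real.exp_le_exp]
      have := Real.log_two_gt_d9
      have hT0 : (0 : ℝ) ≤ T i := by positivity
      -- Here `3 * log 2 ≥ 2` is used.
      nlinarith
    rw [Fintype.card_fin]
    calc Real.exp Q / 2 ^ T i ≤ Real.exp Q / Real.exp (2 * Q) := by gcongr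
      _ = Real.exp (-Q) := by
        rw [← Real.exp_sub]
        ring_nf
      _ ≤ p := exp_neg_log hn (by nlinarith)
  apply one_sub_le_freq
  have hcover : {ω | IsGoodSample G k c S ω}ᶜ ⊆ ((⋃ z, E₁ z) ∪ ⋃ z, E₂ z) ∪ ⋃ i, E₃ i := by
    intro ω hω
    by_contra hbad
    simp only [Set.mem_union, Set.mem_iUnion, not_or, not_exists] at hbad
    obtain ⟨⟨hb₁, hb₂⟩, hb₃⟩ := hbad
    refine hω ⟨fun v w i hi hs => ?_, fun v i hi hx => ?_, fun i hi => ?_⟩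
    · by_contra! hmiss
      exact hb₁ (v, w, ⟨i, by omega⟩) ⟨hs, hmiss⟩
    · by_contra! hlt
      refine hb₂ (v, ⟨i, hi⟩) ⟨fun x hx' => hx x (by simpa [ball] using hx'), ?_⟩
      simpa [ball] using hlt.le
    · have hlt : {v | ω v ∈ S i}.ncard < T i := by
        by_contra! h
        exact hb₃ ⟨i, by omega⟩ h
      have hlt' : ({v | ω v ∈ S i}.ncard : ℝ) ≤ T i := by exact_mod_cast hlt.le
      refine hlt'.trans ?_
      have h₁ := density_pos (k := k) hn i
      have h₂ := Nat.ceil_lt_add_one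
        (by positivity : 0 ≤ 3 * (2 * oversampling n c * density n k i * n))
      have h₃ := one_le_mul_density hn (by omega) (by omega : i ≤ k)
      have h₄ : 1 ≤ oversampling n c * (n * density n k i) := by nlinarith
      simp only [T]
      nlinarith
  refine (freq_mono hcover).trans ((freq_union_le _ _).trans
    ((add_le_add ((freq_union_le _ _).trans (add_le_add (freq_iUnion_le E₁ h₁)
      (freq_iUnion_le E₂ h₂))) (freq_iUnion_le E₃ h₃)).trans ?_))
  simp only [Fintype.card_prod, Fintype.card_fin]
  rw [← add_mul, ← add_mul]
  have hcount : n * (n * (k / 2 + 1)) + n * (k / 2) + (k / 2 + 1) ≤ n ^ 6 := by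
    have h₁ : k / 2 + 1 ≤ n := by omega
    have h₂ : k / 2 ≤ n := by omega
    calc n * (n * (k / 2 + 1)) + n * (k / 2) + (k / 2 + 1) ≤ n * (n * n) + n * n + n := by gcongr
      _ ≤ n * (n * n) + n * (n * n) + n * (n * n) := by nlinarith
      _ = 3 * n ^ 3 := by ring
      _ ≤ n * n ^ 3 := by gcongr
      _ = n ^ 4 := by ring
      _ ≤ n ^ 6 := Nat.pow_le_pow_right (by omega) (by norm_num)
  have hcount' : ((n * (n * (k / 2 + 1)) : ℕ) : ℝ) + ((n * (k / 2) : ℕ) : ℝ) +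
      ((k / 2 + 1 : ℕ) : ℝ) ≤ (n : ℝ) ^ 6 := by exact_mod_cast hcount
  calc _ ≤ (n : ℝ) ^ 6 * p := by gcongr
    _ = 1 / (n : ℝ) ^ c := by
      rw [hp, pow_add]
      field_simp

end Samples

/-! ### The algorithm -/

section Main

open CongestedClique

variable {n k c : ℕ}

/-- The center of the cluster of level `i` of `v`, as computed from the table of `v`. -/
noncomputable def sampledCenter (G : SimpleGraph (Fin n)) (R : ℕ)
    (S : ℕ → Set (Fin (Nat.clog 2 n) → Bool)) (ω : Fin n → Fin (Nat.clog 2 n) → Bool)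
    (i : ℕ) (v : Fin n) : Option (Fin n) :=
  center (nearDist G (Nat.sqrt n) R v) {x | ω x ∈ S i} i

variable {G : SimpleGraph (Fin n)} {R : ℕ} {S : ℕ → Set (Fin (Nat.clog 2 n) → Bool)}
  {ω : Fin n → Fin (Nat.clog 2 n) → Bool}

theorem IsGoodSample.sampledCenter_eq_some_iff (h : IsGoodSample G k c S ω) (hR : k / 2 ≤ R)
    {i : ℕ} (hi : i ≤ k / 2) {v x : Fin n} :
    sampledCenter G R S ω i v = some x ↔ IsCenter G {x | ω x ∈ S i} i v x :=
  center_nearDist (fun w hw => h.hit v w i hi hw) (hi.trans hR)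

theorem IsGoodSample.isClustering (h : IsGoodSample G k c S ω) (hR : k / 2 ≤ R)
    (hS : S 0 = Set.univ) {hop : Fin n → Fin n → Fin n}
    (hhop : ∀ v, IsNextHop G (Nat.sqrt n) R v (hop v)) :
    IsClustering G (sampledCenter G R S ω) hop (k / 2) := by
  have hnext : ∀ i ≤ k / 2, ∀ v x, sampledCenter G R S ω i v = some x → x ≠ v →
      G.Adj v (hop v x) ∧ G.edist (hop v x) x + 1 = G.edist v x := by
    intro i hi v x hx hxv
    have hfin := (center_eq_some_iff.1 hx).2.1
    exact hhop v x hxv (isNear_of_nearDist_ne_top (hfin.trans_lt (ENat.natCast_lt_top i)).ne)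
  refine ⟨fun v => ?_, fun i hi v x hx => ?_, fun i hi v x hx hxv => ?_,
    fun i hi v x hx hxv => ?_, fun i hi v x hx hxv => ?_⟩
  · obtain ⟨x, hx⟩ := exists_isCenter (G := G) (A := {x | ω x ∈ S 0}) (i := 0) (v := v) (x := v)
      (by simp [hS]) (by simp)
    exact ⟨x, (h.sampledCenter_eq_some_iff hR (Nat.zero_le _)).2 hx⟩
  · exact ((h.sampledCenter_eq_some_iff hR hi).1 hx).2.1
  · exact (hnext i hi v x hx hxv).1
  · obtain ⟨hadj, hd⟩ := hnext i hi v x hx hxv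
    rw [h.sampledCenter_eq_some_iff hR hi] at hx ⊢
    exact hx.of_edist_add_one hadj hd
  · exact (hnext i hi v x hx hxv).2

theorem IsGoodSample.ncard_edgeSet_le (h : IsGoodSample G k c S ω) (hR : k / 2 ≤ R)
    (hk : 2 ≤ k) (hkn : k < n) {hop : Fin n → Fin n → Fin n} :
    ((clusterSpanner G (sampledCenter G R S ω) hop ((k - 1) / 2) (k / 2)).edgeSet.ncard : ℝ) ≤
      (300 * (c + 6) ^ 2) * (k * (n : ℝ) ^ (1 + 1 / (k : ℝ))) * Real.log n ^ 2 := by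
  have hn : 3 ≤ n := by omega
  have hn' : (0 : ℝ) < n := by positivity
  have hlog := one_le_log hn
  have hmem : ∀ i v x, sampledCenter G R S ω i v = some x → x ∈ {x | ω x ∈ S i} :=
    fun i v x hx => (center_eq_some_iff.1 hx).1
  have hcount := ncard_edgeSet_clusterSpanner_le (G := G) (C := sampledCenter G R S ω)
    (hop := hop) (d := (k - 1) / 2) (d' := k / 2) (t := maxDegree n k c) (hmem _) (hmem _) (by
      intro v i hi hnone
      refine le_trans (Set.ncard_le_ncard ?_ (Set.toFinite _)) (h.few v i hi fun x hx hxS => ?_)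
      · rintro x ⟨u, hu, hx⟩
        rw [h.sampledCenter_eq_some_iff hR hi.le] at hx
        refine ⟨(G.edist_triangle (v := u)).trans ((add_le_add
          (SimpleGraph.edist_eq_one_iff_adj.2 hu).le hx.2.1).trans ?_), hx.1⟩
        push_cast
        rw [add_comm]
      · obtain ⟨y, hy⟩ := exists_isCenter (A := {x | ω x ∈ S (i + 1)}) hxS hx
        rw [← h.sampledCenter_eq_some_iff hR (by omega), hnone] at hy
        cases hy)
  have hX : (1 : ℝ) ≤ (n : ℝ) ^ (1 / (k : ℝ)) :=
    Real.one_le_rpow (by exact_mod_cast (by omega : 1 ≤ n)) (by positivity)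
  have hsplit : (n : ℝ) ^ (1 + 1 / (k : ℝ)) = n * (n : ℝ) ^ (1 / (k : ℝ)) := by
    rw [Real.rpow_add hn', Real.rpow_one]
  have hdens : density n k ((k - 1) / 2) * density n k (k / 2) * n =
      (n : ℝ) ^ (1 / (k : ℝ)) := by
    rw [density_mul_eq hn, show (k - 1) / 2 + k / 2 = k - 1 by omega]
    unfold density
    nth_rewrite 2 [← Real.rpow_one (n : ℝ)]
    rw [← Real.rpow_add hn']
    congr 1
    rw [Nat.cast_sub (by omega)]
    have : (k : ℝ) ≠ 0 := by positivity
    field_simp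
    push_cast
    ring
  set X := (n : ℝ) ^ (1 / (k : ℝ)) with hXdef
  set l := Real.log n with hl
  have hc0 : (0 : ℝ) ≤ c := by positivity
  have ht : (maxDegree n k c : ℝ) ≤ 3 * X * (c + 6) * l := by
    have h₁ := (Nat.ceil_lt_add_one (by positivity : 0 ≤ 2 * X * (c + 6) * l)).le
    have h₂ : 1 ≤ X * (c + 6) * l := by
      calc (1 : ℝ) = 1 * 1 * 1 := by norm_num
        _ ≤ X * (c + 6) * l := by gcongr; linarith
    calc (maxDegree n k c : ℝ) ≤ 2 * X * (c + 6) * l + 1 := h₁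
      _ ≤ _ := by linarith
  have hk1 : ((k / 2 + 1 : ℕ) : ℝ) ≤ k := by exact_mod_cast (by omega : k / 2 + 1 ≤ k)
  have hkr : (1 : ℝ) ≤ k := by exact_mod_cast (by omega : 1 ≤ k)
  have hA := h.card ((k - 1) / 2) (by omega)
  have hA' := h.card (k / 2) le_rfl
  have hL0 : oversampling n c = 2 * (c + 6) * l := rfl
  have hcount' : ((clusterSpanner G (sampledCenter G R S ω) hop ((k - 1) / 2)
      (k / 2)).edgeSet.ncard : ℝ) ≤ n * ((k / 2 + 1 : ℕ) : ℝ) + n * maxDegree n k c +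
      {v | ω v ∈ S ((k - 1) / 2)}.ncard * {v | ω v ∈ S (k / 2)}.ncard := by
    rw [Fintype.card_fin] at hcount
    exact_mod_cast hcount
  rw [hsplit]
  calc _ ≤ n * ((k / 2 + 1 : ℕ) : ℝ) + n * maxDegree n k c +
        {v | ω v ∈ S ((k - 1) / 2)}.ncard * {v | ω v ∈ S (k / 2)}.ncard := hcount'
    _ ≤ n * (k : ℝ) + n * (3 * X * (c + 6) * l) +
        (8 * oversampling n c * density n k ((k - 1) / 2) * n) *
          (8 * oversampling n c * density n k (k / 2) * n) := by
      have hpos : 0 ≤ 8 * oversampling n c * density n k ((k - 1) / 2) * n :=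
        le_trans (by positivity) hA
      gcongr
    _ = n * (k : ℝ) + n * (3 * X * (c + 6) * l) + 64 * oversampling n c ^ 2 * n *
        (density n k ((k - 1) / 2) * density n k (k / 2) * n) := by ring
    _ = 1 * (k * (n * 1)) * 1 + (3 * (c + 6)) * (1 * (n * X)) * l +
        (256 * (c + 6) ^ 2) * (1 * (n * X)) * l ^ 2 := by rw [hdens, hL0]; ring
    _ ≤ (c + 6) ^ 2 * (k * (n * X)) * l ^ 2 + (3 * (c + 6) ^ 2) * (k * (n * X)) * l ^ 2 +
        (256 * (c + 6) ^ 2) * (k * (n * X)) * l ^ 2 := by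
      have e₁ : (1 : ℝ) ≤ (c + 6) ^ 2 := by nlinarith
      have e₂ : (c + 6 : ℝ) ≤ (c + 6) ^ 2 := by nlinarith
      have e₃ : (1 : ℝ) ≤ l ^ 2 := by nlinarith
      have e₄ : l ≤ l ^ 2 := by nlinarith
      gcongr
    _ = (260 * (c + 6) ^ 2) * (k * (n * X)) * l ^ 2 := by ring
    _ ≤ (300 * (c + 6) ^ 2) * (k * (n * X)) * l ^ 2 := by
      gcongr
      norm_num

/-- For `2 ≤ k < n`, the algorithm exists for every number `2 * j + 6` of rounds with
`k / 2 ≤ 2 ^ j`. -/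
theorem exists_spanner_algorithm (hk : 2 ≤ k) (hkn : k < n) (c : ℕ) {j : ℕ} (hj : k / 2 ≤ 2 ^ j) :
    ∃ A : Algorithm n (4 * Nat.clog 2 n), A.rounds = 2 * j + 6 ∧
      ∀ G : SimpleGraph (Fin n), 1 - 1 / (n : ℝ) ^ c ≤
        A.prob {ω | ∃ H : SimpleGraph (Fin n), A.Constructs G ω H ∧ IsSpanner (2 * k - 1) G H ∧
          (H.edgeSet.ncard : ℝ) ≤
            (300 * (c + 6) ^ 2) * (k * (n : ℝ) ^ (1 + 1 / (k : ℝ))) * Real.log n ^ 2} := by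
  have hn : 3 ≤ n := by omega
  obtain ⟨S, hS, hsub, hlow, hup, hratio⟩ := exists_samples (c := c) hn (by omega : 0 < k)
  -- The largest messages are a pair of an optional table entry and a vertex, and a pair of optional
  -- vertices: messages of `4 * ⌈log₂ n⌉` bits are enough for both.
  have hnb : n ^ 4 ≤ 2 ^ (4 * Nat.clog 2 n) := by
    rw [mul_comm, pow_mul]
    exact Nat.pow_le_pow_left (Nat.le_pow_clog one_lt_two n) 4
  have hb₁ : (n * n + 1) * n ≤ 2 ^ (4 * Nat.clog 2 n) := by
    refine le_trans ?_ hnb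
    calc (n * n + 1) * n ≤ (n * n + n * n) * n := by gcongr; nlinarith
      _ = 2 * n ^ 3 := by ring
      _ ≤ n * n ^ 3 := by gcongr; omega
      _ = n ^ 4 := by ring
  have hb₂ : (n + 1) * (n + 1) ≤ 2 ^ (4 * Nat.clog 2 n) := by
    refine le_trans ?_ hnb
    calc (n + 1) * (n + 1) ≤ (n * n) * (n * n) := by gcongr <;> nlinarith
      _ = n ^ 4 := by ring
  obtain ⟨hop, hhop, hK⟩ := knows_nearDist (n := n) (m := Nat.clog 2 n)
    (Nat.sqrt_pos.2 (by omega)) (Nat.sqrt_le n) hb₁ j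
  have hK₁ := hK.with_input.exchange (μ := Fin (Nat.clog 2 n) → Bool)
    (by simpa using Nat.pow_le_pow_right two_pos (by omega)) fun _ x _ => x.2.2
  have hK₂ := hK₁.map fun v x => ((fun i => center x.1.1.1 {u | x.2 u ∈ S i} i), x.1.1.2, x.1.2.1)
  obtain ⟨send, o, hrun⟩ := (knows_clusterSpanner
    (C := fun G ω => sampledCenter G (2 ^ j) S ω) (hop := hop) hK₂ (d := (k - 1) / 2)
    (d' := k / 2) (by omega) (by omega) hb₂).exists_algorithm
  refine ⟨fullInfo send (2 * j + 1 + 5) o, rfl, fun G => ?_⟩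
  refine (freq_isGoodSample G hk hkn hsub hlow hup hratio).trans
    (freq_mono (α := Fin n → Fin (Nat.clog 2 n) → Bool) fun ω hω => ?_)
  have hω : IsGoodSample G k c S ω := hω
  refine ⟨clusterSpanner G (sampledCenter G (2 ^ j) S ω) (hop G ω) ((k - 1) / 2) (k / 2),
    fun v => hrun G ω v, ?_, hω.ncard_edgeSet_le hj hk hkn⟩
  have := isSpanner_clusterSpanner (d := (k - 1) / 2) (hω.isClustering hj hS (hhop G ω)) (by omega)
  rwa [show 2 * ((k - 1) / 2 + k / 2) + 1 = 2 * k - 1 by omega] at this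

/-- If `k = 1` or `n ≤ k`, the input graph itself is a sparse enough spanner. -/
theorem ncard_edgeSet_le_of_trivial (hn : 1 ≤ n) (hk : k = 1 ∨ 1 ≤ k ∧ n ≤ k) {C : ℝ} (hC : 3 ≤ C)
    (G : SimpleGraph (Fin n)) :
    (G.edgeSet.ncard : ℝ) ≤ C * (k * (n : ℝ) ^ (1 + 1 / (k : ℝ))) * Real.log n ^ 2 := by
  classical
  have hcard : G.edgeSet.ncard ≤ n.choose 2 := by
    have := G.card_edgeFinset_le_card_choose_two
    rwa [Fintype.card_fin, ← SimpleGraph.coe_edgeFinset, Set.ncard_coe_finset] at *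
  rcases hn.eq_or_lt with rfl | hn2
  · have : G.edgeSet.ncard = 0 := by simpa using hcard
    simp [this]
  have hn' : (0 : ℝ) < n := by positivity
  have hlog : Real.log 2 ≤ Real.log n :=
    Real.log_le_log two_pos (by exact_mod_cast hn2)
  have hlog2 := Real.log_two_gt_d9
  have hle : (n : ℝ) ^ 2 ≤ k * (n : ℝ) ^ (1 + 1 / (k : ℝ)) := by
    rcases hk with rfl | ⟨hk, hnk⟩
    · norm_num
    · have h₁ : (n : ℝ) ≤ (n : ℝ) ^ (1 + 1 / (k : ℝ)) := by
        nth_rewrite 1 [← Real.rpow_one (n : ℝ)]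
        exact Real.rpow_le_rpow_of_exponent_le (by exact_mod_cast hn) (by simp)
      rw [sq]
      gcongr
  have hsq : (G.edgeSet.ncard : ℝ) ≤ (n : ℝ) ^ 2 := by
    exact_mod_cast hcard.trans ((Nat.choose_le_pow n 2))
  have hl : 1 ≤ C * Real.log n ^ 2 := by
    have : 1 / 3 ≤ Real.log n ^ 2 := by nlinarith
    nlinarith
  calc (G.edgeSet.ncard : ℝ) ≤ (n : ℝ) ^ 2 := hsq
    _ ≤ k * (n : ℝ) ^ (1 + 1 / (k : ℝ)) := hle
    _ = 1 * (k * (n : ℝ) ^ (1 + 1 / (k : ℝ))) := by ring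
    _ ≤ (C * Real.log n ^ 2) * (k * (n : ℝ) ^ (1 + 1 / (k : ℝ))) := by gcongr
    _ = _ := by ring

/-- The algorithm without communication that outputs the input graph. -/
theorem exists_trivial_algorithm (n b : ℕ) : ∃ A : Algorithm n b, A.rounds = 0 ∧
    ∀ (G : SimpleGraph (Fin n)) (p : ℝ) (P : SimpleGraph (Fin n) → Prop), 0 ≤ p → P G →
      1 - p ≤ A.prob {ω | ∃ H : SimpleGraph (Fin n), A.Constructs G ω H ∧ P H} := by
  obtain ⟨send, o, hrun⟩ := (Knows.of_input (n := n) (m := 0) (b := b)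
    fun _ N _ => N).exists_algorithm
  refine ⟨fullInfo send 0 o, rfl, fun G p P hp hP => ?_⟩
  refine one_sub_le_freq (α := Fin n → Fin 0 → Bool) ?_
  have : {ω | ∃ H : SimpleGraph (Fin n), (fullInfo send 0 o).Constructs G ω H ∧ P H}ᶜ = ∅ := by
    rw [Set.compl_empty_iff]
    exact Set.eq_univ_of_forall fun ω => ⟨G, fun v => hrun G ω v, hP⟩
  refine le_trans (le_of_eq ?_) hp
  refine (congrArg freq this).trans ?_
  simp [freq]

theorem rounds_le (hk : 2 ≤ k) :
    ((2 * Nat.clog 2 (k / 2) + 6 : ℕ) : ℝ) ≤ 12 * Real.log k := by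
  have h₁ : 2 ^ Nat.clog 2 (k / 2) ≤ k := by
    rcases Nat.lt_or_ge (k / 2) 2 with h | h
    · rw [Nat.clog_of_right_le_one (by omega)]
      simp
      omega
    · have := Nat.pow_pred_clog_lt_self one_lt_two (by omega : 1 < k / 2)
      have hpos := Nat.clog_pos one_lt_two h
      have hs : 2 ^ Nat.clog 2 (k / 2) = 2 * 2 ^ (Nat.clog 2 (k / 2)).pred := by
        rw [← pow_succ', ← Nat.succ_eq_add_one, Nat.succ_pred_eq_of_pos hpos]
      omega
  have hlog2 := Real.log_two_gt_d9
  have h₂ : Real.log 2 ≤ Real.log k := Real.log_le_log two_pos (by exact_mod_cast hk)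
  have h₃ : Nat.clog 2 (k / 2) * Real.log 2 ≤ Real.log k := by
    rw [← Real.log_pow]
    exact Real.log_le_log (by positivity) (by exact_mod_cast h₁)
  have h₀ : (0 : ℝ) ≤ Nat.clog 2 (k / 2) := by positivity
  push_cast
  nlinarith

end Main

theorem theorem1 :
    ∃ a β : ℕ, ∀ c : ℕ, ∃ C : ℝ,
      ∃ A : ∀ n _k : ℕ, CongestedClique.Algorithm n (β * Nat.clog 2 n),
        ∀ n k : ℕ, 1 ≤ n → 1 ≤ k →
          ((A n k).rounds : ℝ) ≤ C * Real.log k ∧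
          ∀ G : SimpleGraph (Fin n),
            1 - 1 / (n : ℝ) ^ c ≤
              (A n k).prob {ω | ∃ H : SimpleGraph (Fin n),
                (A n k).Constructs G ω H ∧
                IsSpanner (2 * k - 1) G H ∧
                (H.edgeSet.ncard : ℝ) ≤
                  C * (k * (n : ℝ) ^ (1 + 1 / (k : ℝ))) * Real.log n ^ a} := by
  refine ⟨2, 4, fun c => ⟨300 * (c + 6) ^ 2, ?_⟩⟩
  have hC : (12 : ℝ) ≤ 300 * (c + 6) ^ 2 := by
    have : (0 : ℝ) ≤ c := by positivity
    nlinarith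
  have hex : ∀ n k : ℕ, ∃ A : CongestedClique.Algorithm n (4 * Nat.clog 2 n), 1 ≤ n → 1 ≤ k →
      (A.rounds : ℝ) ≤ 300 * (c + 6) ^ 2 * Real.log k ∧ ∀ G : SimpleGraph (Fin n),
        1 - 1 / (n : ℝ) ^ c ≤ A.prob {ω | ∃ H : SimpleGraph (Fin n), A.Constructs G ω H ∧
          IsSpanner (2 * k - 1) G H ∧ (H.edgeSet.ncard : ℝ) ≤
            (300 * (c + 6) ^ 2) * (k * (n : ℝ) ^ (1 + 1 / (k : ℝ))) * Real.log n ^ 2} := by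
    intro n k
    by_cases hk : 2 ≤ k ∧ k < n
    · obtain ⟨A, hrounds, hA⟩ := exists_spanner_algorithm hk.1 hk.2 c
        (Nat.le_pow_clog one_lt_two (k / 2))
      refine ⟨A, fun _ _ => ⟨?_, hA⟩⟩
      rw [hrounds]
      refine (rounds_le hk.1).trans ?_
      have : 0 ≤ Real.log k := Real.log_natCast_nonneg k
      gcongr
    · obtain ⟨A, hrounds, hA⟩ := exists_trivial_algorithm n (4 * Nat.clog 2 n)
      refine ⟨A, fun hn hk1 => ⟨?_, fun G => ?_⟩⟩
      · rw [hrounds, Nat.cast_zero]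
        have : 0 ≤ Real.log k := Real.log_natCast_nonneg k
        positivity
      · refine hA G _ (fun H => IsSpanner (2 * k - 1) G H ∧ (H.edgeSet.ncard : ℝ) ≤
            (300 * (c + 6) ^ 2) * (k * (n : ℝ) ^ (1 + 1 / (k : ℝ))) * Real.log n ^ 2)
          (by positivity) ⟨⟨le_rfl, fun u v => ?_⟩, ?_⟩
        · have : (1 : ℕ∞) ≤ (2 * k - 1 : ℕ) := by exact_mod_cast (by omega : 1 ≤ 2 * k - 1)
          simpa using mul_le_mul_left this (G.edist u v)
        · exact ncard_edgeSet_le_of_trivial hn (by omega) (by linarith) G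
  choose A hA using hex
  exact ⟨A, hA⟩
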